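/- An edge-ordered graph is a finite simple graph together with a linear order on its edge set; it is non-trivial if it has at least one edge, and it is connected (a tree) if its underlying simple graph is. An edge-ordered graph $H$ contains an edge-ordered graph $G$ if $G$ is isomorphic, by an isomorphism respecting the edge-orders, to a (not necessarily induced) subgraph of $H$ with the inherited edge-order; otherwise $H$ avoids $G$. For non-trivial $G$ let $\mathrm{ex}_<(n,G)$ be the maximal number of edges in an edge-ordered graph on $n$ vertices that avoids $G$. The order chromatic number $\chi_<(G)$ is the smallest chromatic number $\chi(H)$ of a finite simple graph $H$ such that every edge-ordering of $H$ contains $G$ (and $\chi_<(G)=\infty$ if there is no such $H$). The reverse $G^R$ of $G$ has the same underlying simple graph and the reversed edge-order. Edges $e_1<e_2$ of $G$ are consecutive if no edge $e$ of $G$ satisfies $e_1<e<e_2$. $G$ is a semi-caterpillar if its underlying simple graph is a tree with at least one edge and any two consecutive edges $e_1<e_2$ of $G$ either share a vertex or are directly connected by an edge larger than both, that is, there is an edge $e>e_2$ of $G$ joining an endpoint of $e_1$ to an endpoint of $e_2$. **Theorem (Dichotomy).** Let $G$ be an edge-ordered graph. If $G$ or its reverse $G^R$ is a semi-caterpillar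 of order chromatic number $2$, then $\mathrm{ex}_<(n,G)=O(n)$ as $n\to\infty$. If $G$ is connected and non-trivial, and neither $G$ nor $G^R$ is a semi-caterpillar of order chromatic number $2$, then $\mathrm{ex}_<(n,G)=\Omega(n\log n)$ as $n\to\infty$. (The implied constants may depend on $G$.) -/

import Mathlib

/-- An edge-ordered graph on the vertex type `V`: a simple graph together with a (strict) linear
order on its edge set. -/
structure EdgeOrderedGraph (V : Type*) where
  /-- the underlying simple graph -/
  graph : SimpleGraph V
  /-- the edge-order: `lt e f` means `e < f` -/
  lt : graph.edgeSet → graph.edgeSet → Prop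
  isStrictTotalOrder : IsStrictTotalOrder graph.edgeSet lt

namespace EdgeOrderedGraph

variable {V W : Type*}

/-- An edge-ordered graph is non-trivial if it has at least one edge. -/
def IsNontrivial (G : EdgeOrderedGraph V) : Prop := G.graph.edgeSet.Nonempty

/-- `G.reverse` has the same underlying simple graph as `G` and the reversed edge-order. -/
def reverse (G : EdgeOrderedGraph V) : EdgeOrderedGraph V where
  graph := G.graph
  lt e f := G.lt f e
  isStrictTotalOrder := by
    have := G.isStrictTotalOrder
    exact
      { trichotomous := fun a b h₁ h₂ => Std.Trichotomous.trichotomous a b h₂ h₁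
        irrefl := fun a => irrefl_of G.lt a
        trans := fun _ _ _ h₁ h₂ => trans_of G.lt h₂ h₁ }

/-- `H.Contains G`: some (not necessarily induced) subgraph of `H`, with the inherited edge-order,
is isomorphic to `G`. The isomorphism onto the subgraph is given as an injective graph
homomorphism (a `SimpleGraph.Copy`) that respects the edge-orders. -/
def Contains (H : EdgeOrderedGraph W) (G : EdgeOrderedGraph V) : Prop :=
  ∃ f : SimpleGraph.Copy G.graph H.graph,
    ∀ e₁ e₂ : G.graph.edgeSet, G.lt e₁ e₂ ↔ H.lt (f.mapEdgeSet e₁) (f.mapEdgeSet e₂)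

/-- The Turán number `ex_<(n, G)`: the maximal number of edges in an edge-ordered graph on `n`
vertices that avoids `G` (see `isGreatest_turan` for the maximum being attained). -/
noncomputable def turan (n : ℕ) (G : EdgeOrderedGraph V) : ℕ :=
  sSup {m : ℕ | ∃ H : EdgeOrderedGraph (Fin n), ¬ H.Contains G ∧ H.graph.edgeSet.ncard = m}

theorem isGreatest_turan (n : ℕ) (G : EdgeOrderedGraph V) (hG : G.IsNontrivial) :
    IsGreatest {m : ℕ | ∃ H : EdgeOrderedGraph (Fin n),
      ¬ H.Contains G ∧ H.graph.edgeSet.ncard = m} (turan n G) := by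
  have hb : BddAbove {m : ℕ | ∃ H : EdgeOrderedGraph (Fin n),
      ¬ H.Contains G ∧ H.graph.edgeSet.ncard = m} := by
    refine ⟨Nat.card (Sym2 (Fin n)), ?_⟩
    rintro m ⟨H, -, rfl⟩
    rw [← Set.ncard_univ]
    exact Set.ncard_le_ncard (Set.subset_univ _) Set.finite_univ
  refine ⟨Nat.sSup_mem ?_ hb, fun m hm => le_csSup hb hm⟩
  refine ⟨_, ⟨⊥, fun _ _ => False, ?_⟩, ?_, rfl⟩
  · exact
      { trichotomous := fun a => absurd a.2 (by simp)
        irrefl := fun _ h => h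
        trans := fun _ _ _ h _ => h }
  · rintro ⟨f, -⟩
    obtain ⟨e, he⟩ := hG
    exact absurd (f.mapEdgeSet ⟨e, he⟩).2 (by simp)

/-- The order chromatic number `χ_<(G)`: the smallest chromatic number of a finite simple graph
`H` all of whose edge-orderings contain `G`; it is `⊤` (infinity) if no such `H` exists. -/
noncomputable def orderChromaticNumber (G : EdgeOrderedGraph V) : ℕ∞ :=
  sInf {k : ℕ∞ | ∃ (m : ℕ) (H : SimpleGraph (Fin m)),
    (∀ K : EdgeOrderedGraph (Fin m), K.graph = H → K.Contains G) ∧ H.chromaticNumber = k}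

/-- `e₁ < e₂` are consecutive edges: no edge `e` satisfies `e₁ < e < e₂`. -/
def Consecutive (G : EdgeOrderedGraph V) (e₁ e₂ : G.graph.edgeSet) : Prop :=
  G.lt e₁ e₂ ∧ ¬ ∃ e, G.lt e₁ e ∧ G.lt e e₂

/-- A semi-caterpillar: the underlying simple graph is a non-trivial tree, and any two consecutive
edges share a vertex or are directly connected by an edge larger than both of them. -/
def IsSemiCaterpillar (G : EdgeOrderedGraph V) : Prop :=
  G.IsNontrivial ∧ G.graph.IsTree ∧
    ∀ e₁ e₂ : G.graph.edgeSet, G.Consecutive e₁ e₂ →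
      (∃ v : V, v ∈ e₁.1 ∧ v ∈ e₂.1) ∨
      (∃ e : G.graph.edgeSet, G.lt e₁ e ∧ G.lt e₂ e ∧
        ∃ u v : V, u ∈ e₁.1 ∧ v ∈ e₂.1 ∧ e.1 = s(u, v))

end EdgeOrderedGraph

/-!
Everything is phrased through a labelling of the edges that represents the edge-order.

**Linear upper bound.** If `G` has order chromatic number `2`, some bipartite graph contains `G`
under the ordering of its edges by one endpoint, and then by the other. So one class of the
bipartition of `G` is ranked (`RankedClass`): the edges at its vertices form consecutive intervals.
For such a `G` being a semi-caterpillar means that it is a chain of stars (`StarChain`): the star of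
`α (i + 1)` meets the earlier stars only in the leaf `β i` of the last edge of the star of `α i`.
The chain is embedded greedily, star by star. To enter the star of a vertex `u` through `uv` one
needs an earlier edge `av`, and room between `av` and `uv` for the edges at `u` that precede the
entry. Going down from an edge, one of its two ends is the first at which many edges have
been met; directed away from this end, the edge is a *dominant* dart, and dominant darts have the
required room. Discarding the darts with few darts below them costs linearly many darts per star,
so a host with too many edges keeps a dart for the last edge of the last star
(`ncard_edgeSet_le_card_stage`, `attains_of_mem_stage`).

**Lower bound.** The host is a bipartite graph in which positions `x` and `y` are joined when `x - y`
is a power of `3`; it has about `n log n` edges. It suffices to see that if all edge-orders of the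
host contain the connected graph `G`, then `G` or its reverse is a semi-caterpillar of order
chromatic number `2`; the statement on the chromatic number is immediate. Three orders are used.
* Ordering by `x + y` forces, up to reversal, that a neighbour shared by two vertices of the ranked
  class is reached by the last edge at the lower ranked one (`LastShared`). Counting edges then
  shows that `G` is a tree.
* Ordering by `x`, and by `y` or `-y` at each `x`, makes a class ranked, and forces that each of
  its vertices is linked to lower ranked ones through at most one neighbour (`UniqueBack`).

Under these conditions, sending a vertex of the ranked class to the next one with which it shares a
neighbour is an injective map that raises the rank, so it is the successor map
(`LastShared.next_eq_succ`). Hence the last edge at a vertex of the class leads to a neighbour of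
the next vertex, which makes `G` a semi-caterpillar.
-/

/-! ### Labels and containment -/

namespace EdgeOrderedGraph

variable {V W : Type*}

/-- The function `ℓ` on unordered pairs represents the edge-order of `G`: on edges, `e < f` holds
exactly when `ℓ e < ℓ f`. Values outside the edge set are irrelevant. -/
def IsLabel {L : Type*} [LT L] (G : EdgeOrderedGraph V) (ℓ : Sym2 V → L) : Prop :=
  ∀ e f : G.graph.edgeSet, G.lt e f ↔ ℓ e < ℓ f

theorem exists_isLabel_nat [Finite V] (G : EdgeOrderedGraph V) :
    ∃ ℓ : Sym2 V → ℕ, G.IsLabel ℓ := by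
  classical
  have := G.isStrictTotalOrder
  -- the label of an edge counts the smaller edges
  refine ⟨fun e => if h : e ∈ G.graph.edgeSet then {f | G.lt f ⟨e, h⟩}.ncard else 0, ?_⟩
  have mono : ∀ e f : G.graph.edgeSet, G.lt e f →
      {g | G.lt g e}.ncard < {g | G.lt g f}.ncard := fun e f h =>
    Set.ncard_lt_ncard ⟨fun g hg => trans_of G.lt hg h,
      fun hs => irrefl_of G.lt e (hs h)⟩ (Set.toFinite _)
  intro e f
  simp only [Subtype.coe_prop, dif_pos, Subtype.coe_eta]
  refine ⟨mono e f, fun h => ?_⟩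
  rcases trichotomous_of G.lt e f with h' | h' | h'
  · exact h'
  · subst h'; exact absurd h (lt_irrefl _)
  · exact absurd h (mono f e h').le.not_gt

theorem exists_isLabel [Finite V] (G : EdgeOrderedGraph V) :
    ∃ ℓ : Sym2 V → ℤ, G.IsLabel ℓ := by
  obtain ⟨ℓ, h⟩ := G.exists_isLabel_nat
  exact ⟨fun e => ℓ e, fun e f => (h e f).trans (by simp)⟩

theorem IsLabel.neg {G : EdgeOrderedGraph V} {ℓ : Sym2 V → ℤ} (h : G.IsLabel ℓ) :
    G.reverse.IsLabel (fun e => -ℓ e) := fun e f =>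
  (h f e).trans (by simp)

theorem IsLabel.injOn {L : Type*} [Preorder L] {G : EdgeOrderedGraph V} {ℓ : Sym2 V → L}
    (h : G.IsLabel ℓ) : Set.InjOn ℓ G.graph.edgeSet := by
  intro e he f hf hef
  have := G.isStrictTotalOrder
  rcases trichotomous_of G.lt ⟨e, he⟩ ⟨f, hf⟩ with h' | h' | h'
  · exact absurd ((h _ _).1 h') (by simp [hef])
  · exact congrArg Subtype.val h'
  · exact absurd ((h _ _).1 h') (by simp [hef])

/-- The edge-ordered graph whose edges are compared through an injective labelling. -/
def ofLabel {L : Type*} [LinearOrder L] (H : SimpleGraph W) (ℓ : Sym2 W → L)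
    (hℓ : Set.InjOn ℓ H.edgeSet) : EdgeOrderedGraph W where
  graph := H
  lt e f := ℓ e < ℓ f
  isStrictTotalOrder :=
    { trichotomous := fun a b h₁ h₂ =>
        Subtype.ext (hℓ a.2 b.2 (le_antisymm (not_lt.1 h₂) (not_lt.1 h₁)))
      irrefl := fun _ => lt_irrefl _
      trans := fun _ _ _ => lt_trans }

theorem isLabel_ofLabel {L : Type*} [LinearOrder L] (H : SimpleGraph W) (ℓ : Sym2 W → L)
    (hℓ : Set.InjOn ℓ H.edgeSet) : (ofLabel H ℓ hℓ).IsLabel ℓ := fun _ _ => Iff.rfl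

/-- An injective map that preserves adjacency and strict inequalities between labels of edges
witnesses containment; the converse inequality comes for free, the orders being total. -/
theorem contains_of_map {L M : Type*} [Preorder L] [Preorder M] {G : EdgeOrderedGraph V}
    {H : EdgeOrderedGraph W} {ℓ : Sym2 V → L} {m : Sym2 W → M} (hG : G.IsLabel ℓ)
    (hH : H.IsLabel m) (φ : V → W) (hφ : Function.Injective φ)
    (hadj : ∀ x y, G.graph.Adj x y → H.graph.Adj (φ x) (φ y))
    (hlt : ∀ x y x' y', G.graph.Adj x y → G.graph.Adj x' y' → ℓ s(x, y) < ℓ s(x', y') →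
      m s(φ x, φ y) < m s(φ x', φ y')) : H.Contains G := by
  have hs := G.isStrictTotalOrder
  have ht := H.isStrictTotalOrder
  let f : SimpleGraph.Copy G.graph H.graph := ⟨⟨φ, fun {a b} h => hadj a b h⟩, hφ⟩
  have key : ∀ e₁ e₂ : G.graph.edgeSet, G.lt e₁ e₂ → H.lt (f.mapEdgeSet e₁) (f.mapEdgeSet e₂) := by
    rintro ⟨e₁, h₁⟩ ⟨e₂, h₂⟩ h
    induction e₁ with | _ x y
    induction e₂ with | _ x' y'
    rw [hG] at h
    rw [hH]
    exact hlt x y x' y' h₁ h₂ h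
  refine ⟨f, fun e₁ e₂ => ⟨key e₁ e₂, fun h => ?_⟩⟩
  rcases trichotomous_of G.lt e₁ e₂ with h' | h' | h'
  · exact h'
  · subst h'; exact absurd h (irrefl_of H.lt _)
  · exact absurd (trans_of H.lt h (key _ _ h')) (irrefl_of H.lt _)

theorem Contains.exists_map {L M : Type*} [Preorder L] [Preorder M] {G : EdgeOrderedGraph V}
    {H : EdgeOrderedGraph W} {ℓ : Sym2 V → L} {m : Sym2 W → M} (hG : G.IsLabel ℓ)
    (hH : H.IsLabel m) (h : H.Contains G) : ∃ φ : V → W, Function.Injective φ ∧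
    (∀ x y, G.graph.Adj x y → H.graph.Adj (φ x) (φ y)) ∧
    ∀ x y x' y', G.graph.Adj x y → G.graph.Adj x' y' → (ℓ s(x, y) < ℓ s(x', y') ↔
      m s(φ x, φ y) < m s(φ x', φ y')) := by
  obtain ⟨f, hf⟩ := h
  refine ⟨f, f.injective, fun x y hxy => f.toHom.map_adj hxy, fun x y x' y' h h' => ?_⟩
  have := hf ⟨s(x, y), h⟩ ⟨s(x', y'), h'⟩
  rw [hG, hH] at this
  exact this

theorem contains_reverse_iff (G : EdgeOrderedGraph V) (H : EdgeOrderedGraph W) :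
    H.reverse.Contains G.reverse ↔ H.Contains G :=
  ⟨fun ⟨f, hf⟩ => ⟨f, fun e₁ e₂ => hf e₂ e₁⟩, fun ⟨f, hf⟩ => ⟨f, fun e₁ e₂ => hf e₂ e₁⟩⟩

theorem turan_reverse (n : ℕ) (G : EdgeOrderedGraph V) : turan n G.reverse = turan n G := by
  unfold turan
  congr 1
  ext m
  constructor
  · rintro ⟨H, h, e⟩
    exact ⟨H.reverse, fun h' => h ((contains_reverse_iff G.reverse H).1 h'), e⟩
  · rintro ⟨H, h, e⟩
    exact ⟨H.reverse, fun h' => h ((contains_reverse_iff G H).1 h'), e⟩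

/-! ### Bipartition classes of close vertices -/

/-- `A` is a class of a proper `2`-colouring of `Γ`, and `r` ranks its vertices so that the edges
at a vertex of lower rank all precede the edges at a vertex of higher rank. In particular the edges
at each vertex of `A` form an interval of the edge-order. -/
structure RankedClass (Γ : SimpleGraph V) (ℓ : Sym2 V → ℤ) (A : Set V) (r : V → ℤ) : Prop where
  injOn : Set.InjOn r A
  alternating : ∀ x y, Γ.Adj x y → (x ∈ A ↔ y ∉ A)
  lt_of_lt : ∀ a a' b b', a ∈ A → a' ∈ A → Γ.Adj a b → Γ.Adj a' b' → r a < r a' →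
    ℓ s(a, b) < ℓ s(a', b')

namespace RankedClass

variable {Γ : SimpleGraph V} {ℓ : Sym2 V → ℤ} {A : Set V} {r : V → ℤ}

theorem notMem (h : RankedClass Γ ℓ A r) {a b : V} (ha : a ∈ A) (hab : Γ.Adj a b) : b ∉ A :=
  (h.alternating a b hab).1 ha

theorem exists_eq (h : RankedClass Γ ℓ A r) {e : Sym2 V} (he : e ∈ Γ.edgeSet) :
    ∃ a b, a ∈ A ∧ Γ.Adj a b ∧ e = s(a, b) := by
  induction e with | _ x y
  have hxy : Γ.Adj x y := he
  by_cases hx : x ∈ A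
  · exact ⟨x, y, hx, hxy, rfl⟩
  · have : y ∈ A := by by_contra hy; exact hx ((h.alternating x y hxy).2 hy)
    exact ⟨y, x, this, hxy.symm, Sym2.eq_swap⟩

theorem rank_le_of_lt (h : RankedClass Γ ℓ A r) {a a' b b' : V} (ha : a ∈ A) (ha' : a' ∈ A)
    (hab : Γ.Adj a b) (hab' : Γ.Adj a' b') (hl : ℓ s(a, b) < ℓ s(a', b')) : r a ≤ r a' := by
  by_contra! hr
  exact absurd (h.lt_of_lt a' a b' b ha' ha hab' hab hr) hl.not_gt

theorem neg (h : RankedClass Γ ℓ A r) :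
    RankedClass Γ (fun e => -ℓ e) A (fun v => -r v) where
  injOn := fun _ ha _ hb hab => h.injOn ha hb (neg_injective hab)
  alternating := h.alternating
  lt_of_lt := fun a a' b b' ha ha' hab hab' hr =>
    neg_lt_neg (h.lt_of_lt a' a b' b ha' ha hab' hab (neg_lt_neg_iff.1 hr))

/-- Two rankings of the same class agree on vertices that have edges. -/
theorem rank_lt_iff {r' : V → ℤ} (h : RankedClass Γ ℓ A r) (h' : RankedClass Γ ℓ A r')
    {a a' b b' : V} (ha : a ∈ A) (ha' : a' ∈ A) (hab : Γ.Adj a b) (hab' : Γ.Adj a' b') :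
    r a < r a' ↔ r' a < r' a' := by
  have aux : ∀ {s s' : V → ℤ}, RankedClass Γ ℓ A s → RankedClass Γ ℓ A s' →
      s a < s a' → s' a < s' a' := by
    intro s s' hs hs' hlt
    refine lt_of_le_of_ne (hs'.rank_le_of_lt ha ha' hab hab'
      (hs.lt_of_lt _ _ _ _ ha ha' hab hab' hlt)) fun heq => ?_
    rw [hs'.injOn ha ha' heq] at hlt
    exact lt_irrefl _ hlt
  exact ⟨aux h h', aux h' h⟩

end RankedClass

end EdgeOrderedGraph

/-! ### Recognising semi-caterpillars -/

namespace EdgeOrderedGraph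

variable {V W : Type*}

theorem _root_.SimpleGraph.Connected.forall_of_closed {Γ : SimpleGraph V} (h : Γ.Connected)
    (P : V → Prop) (hP : ∀ x y, Γ.Adj x y → P x → P y) {v₀ : V} (h₀ : P v₀) (v : V) : P v := by
  have := (SimpleGraph.reachable_iff_reflTransGen v₀ v).1 (h.preconnected v₀ v)
  induction this with
  | refl => exact h₀
  | tail _ hxy ih => exact hP _ _ hxy ih

theorem _root_.SimpleGraph.Connected.exists_adj_of_edgeSet_nonempty {Γ : SimpleGraph V}
    (h : Γ.Connected) (hne : Γ.edgeSet.Nonempty) (v : V) : ∃ w, Γ.Adj v w := by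
  obtain ⟨e, he⟩ := hne
  induction e with | _ x y
  have : Nontrivial V := ⟨x, y, SimpleGraph.Adj.ne he⟩
  exact h.preconnected.exists_adj_of_nontrivial v

/-- A connected graph has at most two proper `2`-colourings. -/
theorem _root_.SimpleGraph.Connected.eq_or_eq_compl_of_alternating {Γ : SimpleGraph V}
    (h : Γ.Connected) {A B : Set V} (hA : ∀ x y, Γ.Adj x y → (x ∈ A ↔ y ∉ A))
    (hB : ∀ x y, Γ.Adj x y → (x ∈ B ↔ y ∉ B)) : B = A ∨ B = Aᶜ := by
  obtain ⟨v₀⟩ := h.nonempty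
  by_cases h₀ : v₀ ∈ B ↔ v₀ ∈ A
  · refine Or.inl (Set.ext (h.forall_of_closed (fun v => v ∈ B ↔ v ∈ A) ?_ h₀))
    intro x y hxy hx
    have := hA x y hxy
    have := hB x y hxy
    tauto
  · refine Or.inr (Set.ext (h.forall_of_closed (fun v => v ∈ B ↔ v ∈ Aᶜ) ?_
      (v₀ := v₀) (by simp only [Set.mem_compl_iff]; tauto)))
    intro x y hxy hx
    have := hA x y hxy
    have := hB x y hxy
    simp only [Set.mem_compl_iff] at hx ⊢
    tauto

/-- Whenever two vertices of `A` share a neighbour, that neighbour is reached by the last edge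
at the vertex of lower rank. -/
def LastShared (Γ : SimpleGraph V) (ℓ : Sym2 V → ℤ) (A : Set V) (r : V → ℤ) : Prop :=
  ∀ a a' b c, a ∈ A → a' ∈ A → Γ.Adj a b → Γ.Adj a' b → r a < r a' → Γ.Adj a c →
    ℓ s(a, c) ≤ ℓ s(a, b)

/-- If `a` and the higher ranked `a'` share the neighbour `b`, then no other neighbour of `a'` is
adjacent to a vertex of `A` whose rank is at most that of `a`. -/
def UniqueBack (Γ : SimpleGraph V) (A : Set V) (r : V → ℤ) : Prop :=
  ∀ a a' b c a'', a ∈ A → a' ∈ A → a'' ∈ A → Γ.Adj a b → Γ.Adj a' b → r a < r a' → Γ.Adj a' c →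
    c ≠ b → r a'' ≤ r a → ¬ Γ.Adj a'' c

variable {Γ : SimpleGraph V} {ℓ : Sym2 V → ℤ} {A : Set V} {r : V → ℤ}

/-- Every edge `ab` with `a ∈ A` is charged to `b` if `a` is the neighbour of `b` of highest rank,
and to `a` otherwise. The charging is injective and spares the vertices of `A` all of whose
neighbours have no neighbour of higher rank. -/
theorem LastShared.ncard_edgeSet_add_le [Finite V] (h : RankedClass Γ ℓ A r)
    (hinj : Set.InjOn ℓ Γ.edgeSet) (hls : LastShared Γ ℓ A r) (Z : Set V) (hZA : Z ⊆ A)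
    (hZ : ∀ a ∈ Z, ∀ b a', Γ.Adj a b → a' ∈ A → Γ.Adj a' b → r a' ≤ r a) :
    Γ.edgeSet.ncard + Z.ncard ≤ Nat.card V := by
  have hex : ∀ e : Sym2 V, ∃ v, e ∈ Γ.edgeSet → ∃ a b, a ∈ A ∧ Γ.Adj a b ∧ e = s(a, b) ∧
      ((v = b ∧ ∀ a' ∈ A, Γ.Adj a' b → r a' ≤ r a) ∨
        (v = a ∧ ∃ a' ∈ A, Γ.Adj a' b ∧ r a < r a')) := by
    intro e
    by_cases he : e ∈ Γ.edgeSet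
    · obtain ⟨a, b, ha, hab, rfl⟩ := h.exists_eq he
      by_cases hmax : ∀ a' ∈ A, Γ.Adj a' b → r a' ≤ r a
      · exact ⟨b, fun _ => ⟨a, b, ha, hab, rfl, Or.inl ⟨rfl, hmax⟩⟩⟩
      · push Not at hmax
        exact ⟨a, fun _ => ⟨a, b, ha, hab, rfl, Or.inr ⟨rfl, hmax⟩⟩⟩
    · induction e with | _ x y
      exact ⟨x, fun h => absurd h he⟩
  choose Φ hΦ using hex
  have hmaps : ∀ e ∈ Γ.edgeSet, Φ e ∈ Zᶜ := by
    intro e he hmem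
    obtain ⟨a, b, ha, hab, rfl, ⟨hv, -⟩ | ⟨hv, a', ha', hab', hlt⟩⟩ := hΦ e he
    · exact h.notMem ha hab (hv ▸ hZA hmem)
    · exact absurd (hZ a (hv ▸ hmem) b a' hab ha' hab') hlt.not_ge
  have hΦinj : Set.InjOn Φ Γ.edgeSet := by
    intro e he f hf hef
    obtain ⟨a, b, ha, hab, rfl, ⟨hv, hm⟩ | ⟨hv, a', ha', hab', hlt⟩⟩ := hΦ e he <;>
    obtain ⟨c, d, hc, hcd, rfl, ⟨hw, hm'⟩ | ⟨hw, c', hc', hcd', hlt'⟩⟩ := hΦ f hf <;>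
    rw [hv, hw] at hef <;> subst hef
    · rw [h.injOn ha hc (le_antisymm (hm' a ha hab) (hm c hc hcd))]
    · exact absurd hc (h.notMem ha hab)
    · exact absurd ha (h.notMem hc hcd)
    · exact hinj he hf (le_antisymm (hls a c' d b ha hc' hcd hcd' hlt' hab)
        (hls a a' b d ha ha' hab hab' hlt hcd))
  have h1 := Set.ncard_le_ncard_of_injOn Φ hmaps hΦinj (Set.toFinite _)
  have h2 := Set.ncard_add_ncard_compl Z (Set.toFinite _) (Set.toFinite _)
  omega

theorem RankedClass.exists_max [Finite V] (h : RankedClass Γ ℓ A r) (hne : Γ.edgeSet.Nonempty) :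
    ∃ a ∈ A, ∀ a' ∈ A, r a' ≤ r a := by
  obtain ⟨e, he⟩ := hne
  obtain ⟨a, b, ha, -, -⟩ := h.exists_eq he
  exact Set.exists_max_image A r (Set.toFinite _) ⟨a, ha⟩

theorem LastShared.isTree [Finite V] (h : RankedClass Γ ℓ A r) (hinj : Set.InjOn ℓ Γ.edgeSet)
    (hls : LastShared Γ ℓ A r) (hc : Γ.Connected) (hne : Γ.edgeSet.Nonempty) : Γ.IsTree := by
  obtain ⟨a, ha, hmax⟩ := h.exists_max hne
  have h1 := LastShared.ncard_edgeSet_add_le h hinj hls {a} (by simpa using ha)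
    (by rintro _ rfl b a' - ha' -; exact hmax a' ha')
  have h2 := hc.card_vert_le_card_edgeSet_add_one
  rw [SimpleGraph.isTree_iff_connected_and_card]
  rw [Set.ncard_singleton] at h1
  rw [Nat.card_coe_set_eq] at h2 ⊢
  exact ⟨hc, by omega⟩

/-- By connectedness at most one vertex of `A`, the one of highest rank, can be spared by the
charging of `LastShared.ncard_edgeSet_add_le`. -/
theorem LastShared.exists_forward [Finite V] (h : RankedClass Γ ℓ A r)
    (hinj : Set.InjOn ℓ Γ.edgeSet) (hls : LastShared Γ ℓ A r) (hc : Γ.Connected)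
    {a a₁ : V} (ha : a ∈ A) (ha₁ : a₁ ∈ A) (hlt : r a < r a₁) :
    ∃ b w, Γ.Adj a b ∧ w ∈ A ∧ Γ.Adj w b ∧ r a < r w := by
  by_contra! hno
  obtain ⟨m, hm, hmax⟩ := Set.exists_max_image A r (Set.toFinite _) ⟨a, ha⟩
  have hne : a ≠ m := by
    rintro rfl
    exact absurd (hmax a₁ ha₁) hlt.not_ge
  have h1 := LastShared.ncard_edgeSet_add_le h hinj hls {a, m}
    (by rintro _ (rfl | rfl) <;> assumption) (by
      rintro _ (rfl | rfl) b a' hab ha' hab'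
      · exact hno b a' hab ha' hab'
      · exact hmax a' ha')
  have h2 := hc.card_vert_le_card_edgeSet_add_one
  rw [Set.ncard_pair hne] at h1
  rw [Nat.card_coe_set_eq] at h2
  omega

/-- The vertex `w` is the next vertex of `A` after `a` with which `a` shares the neighbour `b`. -/
theorem LastShared.exists_next [Finite V] (h : RankedClass Γ ℓ A r)
    (hinj : Set.InjOn ℓ Γ.edgeSet) (hls : LastShared Γ ℓ A r) (hc : Γ.Connected)
    {a a₁ : V} (ha : a ∈ A) (ha₁ : a₁ ∈ A) (hlt : r a < r a₁) :
    ∃ b w, Γ.Adj a b ∧ w ∈ A ∧ Γ.Adj w b ∧ r a < r w ∧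
      ∀ z ∈ A, Γ.Adj z b → r a < r z → r w ≤ r z := by
  obtain ⟨b, w, hab, hw⟩ := LastShared.exists_forward h hinj hls hc ha ha₁ hlt
  obtain ⟨w, ⟨hwA, hwb, hw⟩, hmin⟩ := Set.exists_min_image {w | w ∈ A ∧ Γ.Adj w b ∧ r a < r w} r
    (Set.toFinite _) ⟨w, hw⟩
  exact ⟨b, w, hab, hwA, hwb, hw, fun z hz hzb hlt => hmin z ⟨hz, hzb, hlt⟩⟩

/-- Sending a vertex of `A` to the next vertex of `A` with which it shares a neighbour is injective
and increases the rank, hence it is the successor map. -/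
theorem LastShared.next_eq_succ [Finite V] (h : RankedClass Γ ℓ A r)
    (hinj : Set.InjOn ℓ Γ.edgeSet) (hls : LastShared Γ ℓ A r) (hub : UniqueBack Γ A r)
    (hc : Γ.Connected) {a b w z : V} (ha : a ∈ A) (hab : Γ.Adj a b) (hw : w ∈ A)
    (hwb : Γ.Adj w b) (hnext : ∀ z ∈ A, Γ.Adj z b → r a < r z → r w ≤ r z)
    (hz : z ∈ A) (haz : r a < r z) (hzw : r z < r w) : False := by
  -- a counterexample of highest rank
  obtain ⟨a, ⟨ha, b, w, hab, hw, hwb, hnext, z, hz, haz, hzw⟩, hmax⟩ := Set.exists_max_image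
    {a | a ∈ A ∧ ∃ b w, Γ.Adj a b ∧ w ∈ A ∧ Γ.Adj w b ∧
      (∀ z ∈ A, Γ.Adj z b → r a < r z → r w ≤ r z) ∧ ∃ z ∈ A, r a < r z ∧ r z < r w} r
    (Set.toFinite _) ⟨a, ha, b, w, hab, hw, hwb, hnext, z, hz, haz, hzw⟩
  -- let `z` be the predecessor of `w` in `A`; its next vertex is `w` as well
  obtain ⟨z, ⟨hz, haz, hzw⟩, hzmax⟩ := Set.exists_max_image
    {z | z ∈ A ∧ r a < r z ∧ r z < r w} r (Set.toFinite _) ⟨z, hz, haz, hzw⟩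
  obtain ⟨b', w', hzb', hw', hwb', hzw', hnext'⟩ :=
    LastShared.exists_next h hinj hls hc hz hw hzw
  have hww' : w' = w := by
    refine h.injOn hw' hw (le_antisymm ?_ ?_)
    · by_contra! hlt
      exact absurd (hmax z ⟨hz, b', w', hzb', hw', hwb', hnext', w, hw, hzw, hlt⟩) haz.not_ge
    · by_contra! hlt
      exact absurd (hzmax w' ⟨hw', haz.trans hzw', hlt⟩) hzw'.not_ge
  subst hww'
  by_cases hbb : b = b'
  · subst hbb
    exact absurd (hnext z hz hzb' haz) hzw.not_ge
  · exact hub z w' b' b a hz hw ha hzb' hwb' hzw hwb hbb haz.le hab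

section

variable {G : EdgeOrderedGraph V}

/-- If both classes of the bipartition are ranked, then consecutive edges share a vertex. -/
theorem isSemiCaterpillar_of_both_ranked {s : V → ℤ} (hG : G.IsLabel ℓ)
    (hA : RankedClass G.graph ℓ A r) (hB : RankedClass G.graph ℓ Aᶜ s) (ht : G.graph.IsTree)
    (hne : G.IsNontrivial) : G.IsSemiCaterpillar := by
  refine ⟨hne, ht, ?_⟩
  rintro ⟨e₁, h₁⟩ ⟨e₂, h₂⟩ ⟨hlt, hno⟩
  obtain ⟨a, b, ha, hab, rfl⟩ := hA.exists_eq h₁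
  obtain ⟨a', b', ha', hab', rfl⟩ := hA.exists_eq h₂
  have hlt' : ℓ s(a, b) < ℓ s(a', b') := (hG _ _).1 hlt
  refine Or.inl ?_
  by_contra! hdis
  have hb := hA.notMem ha hab
  have hb' := hA.notMem ha' hab'
  have hra : r a < r a' := by
    refine lt_of_le_of_ne (hA.rank_le_of_lt ha ha' hab hab' hlt') fun heq => ?_
    exact hdis a (by simp) (by simp [hA.injOn ha ha' heq])
  have hsb : s b < s b' := by
    refine lt_of_le_of_ne (hB.rank_le_of_lt hb hb' hab.symm hab'.symm
      (by rwa [Sym2.eq_swap, Sym2.eq_swap (a := b')])) fun heq => ?_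
    exact hdis b (by simp) (by simp [hB.injOn hb hb' heq])
  -- the vertices of rank at most that of `a` or `b` are closed under adjacency
  have hcl : ∀ x y, x ∈ A → G.graph.Adj x y → (r x ≤ r a ↔ s y ≤ s b) := by
    intro x y hx hxy
    have hy := hA.notMem hx hxy
    constructor
    · intro hxa
      by_contra! hsy
      refine hno ⟨⟨s(x, y), hxy⟩, (hG _ _).2 ?_,
        (hG _ _).2 (hA.lt_of_lt _ _ _ _ hx ha' hxy hab' (hxa.trans_lt hra))⟩
      have := hB.lt_of_lt _ _ _ _ hb hy hab.symm hxy.symm hsy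
      rwa [Sym2.eq_swap, Sym2.eq_swap (a := y)] at this
    · intro hsy
      by_contra! hxa
      refine hno ⟨⟨s(x, y), hxy⟩, (hG _ _).2 (hA.lt_of_lt _ _ _ _ ha hx hab hxy hxa),
        (hG _ _).2 ?_⟩
      have := hB.lt_of_lt _ _ _ _ hy hb' hxy.symm hab'.symm (hsy.trans_lt hsb)
      rwa [Sym2.eq_swap, Sym2.eq_swap (a := b')] at this
  have key := ht.connected.forall_of_closed
    (fun x => (x ∈ A → r x ≤ r a) ∧ (x ∉ A → s x ≤ s b)) ?_ (v₀ := a)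
    ⟨fun _ => le_rfl, fun h => absurd ha h⟩ a'
  · exact absurd (key.1 ha') hra.not_ge
  · rintro x y hxy ⟨hx1, hx2⟩
    by_cases hx : x ∈ A
    · have hy := hA.notMem hx hxy
      exact ⟨fun h => absurd h hy, fun _ => (hcl x y hx hxy).1 (hx1 hx)⟩
    · have hy : y ∈ A := by by_contra hy; exact hx ((hA.alternating x y hxy).2 hy)
      exact ⟨fun _ => (hcl y x hy hxy.symm).2 (hx2 hx), fun h => absurd hy h⟩

theorem isSemiCaterpillar_of_lastShared [Finite V] (hG : G.IsLabel ℓ) (hA : RankedClass G.graph ℓ A r)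
    (hls : LastShared G.graph ℓ A r) (hub : UniqueBack G.graph A r) (hc : G.graph.Connected)
    (hne : G.IsNontrivial) : G.IsSemiCaterpillar := by
  refine ⟨hne, LastShared.isTree hA hG.injOn hls hc hne, ?_⟩
  rintro ⟨e₁, h₁⟩ ⟨e₂, h₂⟩ ⟨hlt, hno⟩
  obtain ⟨a, b, ha, hab, rfl⟩ := hA.exists_eq h₁
  obtain ⟨a', b', ha', hab', rfl⟩ := hA.exists_eq h₂
  have hlt' : ℓ s(a, b) < ℓ s(a', b') := (hG _ _).1 hlt
  have hno' : ∀ x y, G.graph.Adj x y → ℓ s(a, b) < ℓ s(x, y) → ℓ s(a', b') ≤ ℓ s(x, y) := by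
    intro x y hxy h
    by_contra! h'
    exact hno ⟨⟨s(x, y), hxy⟩, (hG _ _).2 h, (hG _ _).2 h'⟩
  rcases (hA.rank_le_of_lt ha ha' hab hab' hlt').eq_or_lt with heq | hr
  · exact Or.inl ⟨a, by simp, by simp [hA.injOn ha ha' heq]⟩
  obtain ⟨c, w, hac, hw, hwc, haw, hnext⟩ :=
    LastShared.exists_next hA hG.injOn hls hc ha ha' hr
  have hwa : w = a' := by
    refine hA.injOn hw ha' (le_antisymm ?_ ?_)
    · by_contra! h
      exact LastShared.next_eq_succ hA hG.injOn hls hub hc ha hac hw hwc hnext ha' hr h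
    · by_contra! h
      exact absurd (hno' w c hwc (hA.lt_of_lt _ _ _ _ ha hw hab hwc haw))
        (hA.lt_of_lt _ _ _ _ hw ha' hwc hab' h).not_ge
  subst hwa
  have hcb : ℓ s(a, b) = ℓ s(a, c) := by
    refine le_antisymm (hls a w c b ha hw hac hwc haw hab) ?_
    by_contra! h
    exact absurd (hno' a c hac h) (hA.lt_of_lt _ _ _ _ ha hw hac hab' haw).not_ge
  have hbc : b = c := Sym2.congr_right.1 (hG.injOn hab hac hcb)
  subst hbc
  by_cases hbb : b = b'
  · exact Or.inl ⟨b, by simp, by simp [hbb]⟩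
  · have hlt1 := hA.lt_of_lt _ _ _ _ ha hw hab hwc haw
    refine Or.inr ⟨⟨s(w, b), hwc⟩, (hG _ _).2 hlt1, (hG _ _).2 (lt_of_le_of_ne
      (hno' w b hwc hlt1) fun heq => hbb ?_), b, w, by simp, by simp, Sym2.eq_swap⟩
    exact (Sym2.congr_right.1 (hG.injOn hab' hwc heq)).symm

end

end EdgeOrderedGraph

/-! ### The host graph and its three edge-orders -/

namespace EdgeOrderedGraph

variable {V W : Type*}

/-- The left vertices of the host graph on `Fin n`. -/
def leftSide (n : ℕ) : Set (Fin n) := {v | v.val < n / 2}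

/-- The position of a vertex of the host graph: each of the two sides is a row of consecutive
integers, and both rows start at `n / 2`. -/
def pos {n : ℕ} (v : Fin n) : ℕ := if v.val < n / 2 then v.val + n / 2 else v.val

theorem pos_lt {n : ℕ} (v : Fin n) : pos v < 2 * n := by
  have := v.2
  unfold pos; split_ifs <;> omega

theorem eq_of_pos_eq {n : ℕ} {u v : Fin n} (h : u ∈ leftSide n ↔ v ∈ leftSide n)
    (hp : pos u = pos v) : u = v := by
  simp only [leftSide, Set.mem_ofPred_eq] at h
  unfold pos at hp
  ext
  split_ifs at hp <;> omega

/-- The host graph on `n` vertices: a left and a right vertex are joined if the position of the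
left one exceeds that of the right one by a power of `3`. -/
def hostGraph (n : ℕ) : SimpleGraph (Fin n) where
  Adj u v := (u ∈ leftSide n ∧ v ∉ leftSide n ∧ ∃ k, pos u = pos v + 3 ^ k) ∨
    (v ∈ leftSide n ∧ u ∉ leftSide n ∧ ∃ k, pos v = pos u + 3 ^ k)
  symm := ⟨fun _ _ h => Or.symm h⟩
  loopless := ⟨fun _ h => by tauto⟩

theorem hostGraph_alternating {n : ℕ} (u v : Fin n) (h : (hostGraph n).Adj u v) :
    u ∈ leftSide n ↔ v ∉ leftSide n := by
  rcases h with h | h <;> tauto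

theorem hostGraph_pos {n : ℕ} {u v : Fin n} (h : (hostGraph n).Adj u v) (hu : u ∈ leftSide n) :
    v ∉ leftSide n ∧ ∃ k, pos u = pos v + 3 ^ k := by
  rcases h with h | h <;> tauto

theorem hostGraph_exists_eq {n : ℕ} {e : Sym2 (Fin n)} (he : e ∈ (hostGraph n).edgeSet) :
    ∃ u v, u ∈ leftSide n ∧ v ∉ leftSide n ∧ e = s(u, v) := by
  induction e with | _ u v
  rcases he with h | h
  · exact ⟨u, v, h.1, h.2.1, rfl⟩
  · exact ⟨v, u, h.1, h.2.1, Sym2.eq_swap⟩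

/-- The label of an edge is the sum of the weights of its endpoints, for weights which are pairs of
natural numbers, and labels are compared lexicographically. -/
def sumLabel (p q : W → ℕ) (e : Sym2 W) : ℕ ×ₗ ℕ :=
  toLex (e.lift ⟨fun u v => p u + p v, fun u v => add_comm (p u) (p v)⟩,
    e.lift ⟨fun u v => q u + q v, fun u v => add_comm (q u) (q v)⟩)

theorem sumLabel_lt (p q : W → ℕ) (a b c d : W) : sumLabel p q s(a, b) < sumLabel p q s(c, d) ↔
    p a + p b < p c + p d ∨ (p a + p b = p c + p d ∧ q a + q b < q c + q d) := by
  simp [sumLabel, Prod.Lex.lt_iff]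

theorem sumLabel_eq (p q : W → ℕ) (a b c d : W) : sumLabel p q s(a, b) = sumLabel p q s(c, d) ↔
    p a + p b = p c + p d ∧ q a + q b = q c + q d := by
  simp [sumLabel, Prod.ext_iff]

open scoped Classical in
/-- The position of a left vertex, and `0` for a right vertex. -/
noncomputable def posLeft {n : ℕ} (v : Fin n) : ℕ := if v ∈ leftSide n then pos v else 0

open scoped Classical in
/-- The position of a right vertex, and `0` for a left vertex. -/
noncomputable def posRight {n : ℕ} (v : Fin n) : ℕ := if v ∈ leftSide n then 0 else pos v

open scoped Classical in
/-- The positions of the right vertices in reversed order, and `0` for a left vertex. -/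
noncomputable def negRight {n : ℕ} (v : Fin n) : ℕ := if v ∈ leftSide n then 0 else 2 * n - pos v

theorem injOn_sumLabel_sum (n : ℕ) :
    Set.InjOn (sumLabel (pos (n := n)) posLeft) (hostGraph n).edgeSet := by
  intro e he f hf hef
  obtain ⟨u, v, hu, hv, rfl⟩ := hostGraph_exists_eq he
  obtain ⟨u', v', hu', hv', rfl⟩ := hostGraph_exists_eq hf
  rw [sumLabel_eq] at hef
  simp only [posLeft, hu, hv, hu', hv', if_true, if_false] at hef
  rw [eq_of_pos_eq (u := u) (v := u') (by tauto) (by omega),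
    eq_of_pos_eq (u := v) (v := v') (by tauto) (by omega)]

theorem injOn_sumLabel_inc (n : ℕ) :
    Set.InjOn (sumLabel (posLeft (n := n)) posRight) (hostGraph n).edgeSet := by
  intro e he f hf hef
  obtain ⟨u, v, hu, hv, rfl⟩ := hostGraph_exists_eq he
  obtain ⟨u', v', hu', hv', rfl⟩ := hostGraph_exists_eq hf
  rw [sumLabel_eq] at hef
  simp only [posLeft, posRight, hu, hv, hu', hv', if_true, if_false] at hef
  rw [eq_of_pos_eq (u := u) (v := u') (by tauto) (by omega),
    eq_of_pos_eq (u := v) (v := v') (by tauto) (by omega)]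

theorem injOn_sumLabel_dec (n : ℕ) :
    Set.InjOn (sumLabel (posLeft (n := n)) negRight) (hostGraph n).edgeSet := by
  intro e he f hf hef
  obtain ⟨u, v, hu, hv, rfl⟩ := hostGraph_exists_eq he
  obtain ⟨u', v', hu', hv', rfl⟩ := hostGraph_exists_eq hf
  rw [sumLabel_eq] at hef
  simp only [posLeft, negRight, hu, hv, hu', hv', if_true, if_false] at hef
  have := pos_lt v
  have := pos_lt v'
  rw [eq_of_pos_eq (u := u) (v := u') (by tauto) (by omega),
    eq_of_pos_eq (u := v) (v := v') (by tauto) (by omega)]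

/-- The host graph with its edges ordered by the sum of the positions of their endpoints. -/
noncomputable def sumOrder (n : ℕ) : EdgeOrderedGraph (Fin n) :=
  ofLabel (hostGraph n) (sumLabel pos posLeft) (injOn_sumLabel_sum n)

/-- The host graph with its edges ordered by the left endpoint, the edges at a left vertex being
ordered by increasing position of the right endpoint. -/
noncomputable def incOrder (n : ℕ) : EdgeOrderedGraph (Fin n) :=
  ofLabel (hostGraph n) (sumLabel posLeft posRight) (injOn_sumLabel_inc n)

/-- The host graph with its edges ordered by the left endpoint, the edges at a left vertex being
ordered by decreasing position of the right endpoint. -/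
noncomputable def decOrder (n : ℕ) : EdgeOrderedGraph (Fin n) :=
  ofLabel (hostGraph n) (sumLabel posLeft negRight) (injOn_sumLabel_dec n)

theorem three_pow_mul_le {k l : ℕ} (h : 3 ^ k < 3 ^ l) : 3 * 3 ^ k ≤ 3 ^ l := by
  have : k < l := (Nat.pow_lt_pow_iff_right (by norm_num)).1 h
  calc 3 * 3 ^ k = 3 ^ (k + 1) := by ring
    _ ≤ 3 ^ l := Nat.pow_le_pow_right (by norm_num) this

/-- In the host graph, a neighbour `y'` of `x'` to the right of a neighbour `y` that `x'` shares
with an earlier `x` lies beyond `x`, hence is not adjacent to anything up to `x`. -/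
theorem hostGraph_not_adj {n : ℕ} {x x' x'' y y' : Fin n} (hx : x ∈ leftSide n)
    (hx' : x' ∈ leftSide n) (hx'' : x'' ∈ leftSide n) (h : (hostGraph n).Adj x y)
    (h' : (hostGraph n).Adj x' y) (hy : (hostGraph n).Adj x' y') (hlt : pos x < pos x')
    (hyy : pos y < pos y') (hle : pos x'' ≤ pos x) : ¬ (hostGraph n).Adj x'' y' := by
  intro hadj
  obtain ⟨-, k, hk⟩ := hostGraph_pos h hx
  obtain ⟨-, k', hk'⟩ := hostGraph_pos h' hx'
  obtain ⟨-, l, hl⟩ := hostGraph_pos hy hx'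
  obtain ⟨-, m, hm⟩ := hostGraph_pos hadj hx''
  have h1 : 3 * 3 ^ k ≤ 3 ^ k' := three_pow_mul_le (by omega)
  have h2 : 3 * 3 ^ l ≤ 3 ^ k' := three_pow_mul_le (by omega)
  have h3 : 0 < 3 ^ m := by positivity
  omega

/-- In the order by sums, if an edge `xy` is followed by `xy'` and by `x'y`, then `xy'` comes
before `x'y`. -/
theorem hostGraph_sum_after {n : ℕ} {x x' y y' : Fin n} (hx : x ∈ leftSide n)
    (hx' : x' ∈ leftSide n) (hf : (hostGraph n).Adj x y) (hg : (hostGraph n).Adj x' y)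
    (hh : (hostGraph n).Adj x y')
    (hfg : sumLabel pos posLeft s(x, y) < sumLabel pos posLeft s(x', y)) :
    sumLabel pos posLeft s(x, y') < sumLabel pos posLeft s(x', y) := by
  obtain ⟨hy, k, hk⟩ := hostGraph_pos hf hx
  obtain ⟨-, k', hk'⟩ := hostGraph_pos hg hx'
  obtain ⟨hy', l, hl⟩ := hostGraph_pos hh hx
  rw [sumLabel_lt] at hfg ⊢
  simp only [posLeft, hx, hx', hy, if_true, if_false] at hfg
  have h1 : 3 * 3 ^ k ≤ 3 ^ k' := three_pow_mul_le (by omega)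
  have h2 : 0 < 3 ^ l := by positivity
  omega

/-- In the order by sums, if an edge `xy` is preceded by `xy'` and by `x'y`, then `xy'` comes
before `x'y`. -/
theorem hostGraph_sum_before {n : ℕ} {x x' y y' : Fin n} (hx : x ∈ leftSide n)
    (hx' : x' ∈ leftSide n) (hf : (hostGraph n).Adj x y) (hg : (hostGraph n).Adj x' y)
    (hh : (hostGraph n).Adj x y')
    (hhf : sumLabel pos posLeft s(x, y') < sumLabel pos posLeft s(x, y)) :
    sumLabel pos posLeft s(x, y') < sumLabel pos posLeft s(x', y) := by
  obtain ⟨hy, k, hk⟩ := hostGraph_pos hf hx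
  obtain ⟨-, k', hk'⟩ := hostGraph_pos hg hx'
  obtain ⟨hy', l, hl⟩ := hostGraph_pos hh hx
  rw [sumLabel_lt] at hhf ⊢
  simp only [posLeft, hx, hy, hy', if_true, if_false] at hhf
  have h1 : 3 * 3 ^ k ≤ 3 ^ l := three_pow_mul_le (by omega)
  have h2 : 0 < 3 ^ k' := by positivity
  omega

/-! ### Graphs contained in the ordered host graphs -/

variable {G : EdgeOrderedGraph V} {ℓ : Sym2 V → ℤ} {A : Set V} {r : V → ℤ} {n : ℕ}

/-- A copy in a host that is ordered by left endpoints makes the class mapped to the left side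
ranked, by position. -/
theorem rankedClass_of_map {φ : V → Fin n} {q : Fin n → ℕ} (hφ : Function.Injective φ)
    (hadj : ∀ x y, G.graph.Adj x y → (hostGraph n).Adj (φ x) (φ y))
    (hlt : ∀ x y x' y', G.graph.Adj x y → G.graph.Adj x' y' → (ℓ s(x, y) < ℓ s(x', y') ↔
      sumLabel posLeft q s(φ x, φ y) < sumLabel posLeft q s(φ x', φ y'))) :
    RankedClass G.graph ℓ (φ ⁻¹' leftSide n) (fun v => pos (φ v)) where
  injOn := fun a ha b hb hab => hφ (eq_of_pos_eq (iff_of_true ha hb) (by simpa using hab))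
  alternating := fun x y hxy => hostGraph_alternating _ _ (hadj x y hxy)
  lt_of_lt := by
    intro a a' b b' ha ha' hab hab' hr
    rw [hlt a b a' b' hab hab', sumLabel_lt]
    simp only [Set.mem_preimage] at ha ha'
    have hb := (hostGraph_pos (hadj _ _ hab) ha).1
    have hb' := (hostGraph_pos (hadj _ _ hab') ha').1
    simp only [posLeft, ha, ha', hb, hb', if_true, if_false]
    omega

theorem exists_rankedClass_of_incOrder (hG : G.IsLabel ℓ) (h : (incOrder n).Contains G) :
    ∃ A r, RankedClass G.graph ℓ A r ∧ ∀ a a' b c a'', a ∈ A → a' ∈ A → a'' ∈ A →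
      G.graph.Adj a b → G.graph.Adj a' b → r a < r a' → G.graph.Adj a' c →
      ℓ s(a', b) < ℓ s(a', c) → r a'' ≤ r a → ¬ G.graph.Adj a'' c := by
  obtain ⟨φ, hφ, hadj, hlt⟩ := h.exists_map hG (isLabel_ofLabel _ _ (injOn_sumLabel_inc n))
  refine ⟨_, _, rankedClass_of_map hφ hadj hlt, ?_⟩
  intro a a' b c a'' ha ha' ha'' hab hab' hr hac hl hle hadj'
  simp only [Set.mem_preimage] at ha ha' ha''
  have hb := (hostGraph_pos (hadj _ _ hab) ha).1
  have hc := (hostGraph_pos (hadj _ _ hac) ha').1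
  rw [hlt _ _ _ _ hab' hac, sumLabel_lt] at hl
  simp only [posLeft, posRight, ha', hb, hc, if_true, if_false] at hl
  exact hostGraph_not_adj ha ha' ha'' (hadj _ _ hab) (hadj _ _ hab') (hadj _ _ hac) (by omega)
    (by omega) (by omega) (hadj _ _ hadj')

theorem exists_rankedClass_of_decOrder (hG : G.IsLabel ℓ) (h : (decOrder n).Contains G) :
    ∃ A r, RankedClass G.graph ℓ A r ∧ ∀ a a' b c a'', a ∈ A → a' ∈ A → a'' ∈ A →
      G.graph.Adj a b → G.graph.Adj a' b → r a < r a' → G.graph.Adj a' c →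
      ℓ s(a', c) < ℓ s(a', b) → r a'' ≤ r a → ¬ G.graph.Adj a'' c := by
  obtain ⟨φ, hφ, hadj, hlt⟩ := h.exists_map hG (isLabel_ofLabel _ _ (injOn_sumLabel_dec n))
  refine ⟨_, _, rankedClass_of_map hφ hadj hlt, ?_⟩
  intro a a' b c a'' ha ha' ha'' hab hab' hr hac hl hle hadj'
  simp only [Set.mem_preimage] at ha ha' ha''
  have hb := (hostGraph_pos (hadj _ _ hab) ha).1
  have hc := (hostGraph_pos (hadj _ _ hac) ha').1
  rw [hlt _ _ _ _ hac hab', sumLabel_lt] at hl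
  simp only [posLeft, negRight, ha', hb, hc, if_true, if_false] at hl
  exact hostGraph_not_adj ha ha' ha'' (hadj _ _ hab) (hadj _ _ hab') (hadj _ _ hac) (by omega)
    (by omega) (by omega) (hadj _ _ hadj')

/-- The order by sums forces shared neighbours to be last at the lower ranked vertex if the ranked
class is mapped to the right side, and to be first at the higher ranked vertex if it is mapped
to the left side. -/
theorem lastShared_or_of_sumOrder (hG : G.IsLabel ℓ) (hA : RankedClass G.graph ℓ A r)
    (hc : G.graph.Connected) (h : (sumOrder n).Contains G) :
    LastShared G.graph ℓ A r ∨ LastShared G.graph (fun e => -ℓ e) A (fun v => -r v) := by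
  obtain ⟨φ, hφ, hadj, hlt⟩ := h.exists_map hG (isLabel_ofLabel _ _ (injOn_sumLabel_sum n))
  have hP : ∀ x y, G.graph.Adj x y → (x ∈ φ ⁻¹' leftSide n ↔ y ∉ φ ⁻¹' leftSide n) :=
    fun x y hxy => hostGraph_alternating _ _ (hadj x y hxy)
  rcases hc.eq_or_eq_compl_of_alternating hA.alternating hP with hX | hX
  · have hX' : ∀ v, v ∈ A → φ v ∈ leftSide n := fun v hv => by rw [← hX] at hv; exact hv
    refine Or.inr fun a a' b c ha ha' hab ha'b hr hac => neg_le_neg ?_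
    by_contra! hl
    have hg := hA.lt_of_lt _ _ _ _ ha' ha ha'b hac (neg_lt_neg_iff.1 hr)
    rw [hlt _ _ _ _ hac hab] at hl
    rw [hlt _ _ _ _ ha'b hac] at hg
    exact absurd (hostGraph_sum_before (hX' a ha) (hX' a' ha') (hadj _ _ hab) (hadj _ _ ha'b)
      (hadj _ _ hac) hl) hg.not_gt
  · have hX' : ∀ a v, a ∈ A → G.graph.Adj a v → φ v ∈ leftSide n := fun a v ha hav => by
      have hv := hA.notMem ha hav
      rw [← Set.mem_compl_iff, ← hX] at hv
      exact hv
    refine Or.inl fun a a' b c ha ha' hab ha'b hr hac => ?_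
    by_contra! hl
    have hg := hA.lt_of_lt _ _ _ _ ha ha' hac ha'b hr
    rw [hlt _ _ _ _ hab hac, Sym2.eq_swap, Sym2.eq_swap (a := φ a)] at hl
    rw [hlt _ _ _ _ hac ha'b, Sym2.eq_swap, Sym2.eq_swap (a := φ a')] at hg
    exact absurd (hostGraph_sum_after (hX' a b ha hab) (hX' a c ha hac) (hadj _ _ hab.symm)
      (hadj _ _ hac.symm) (hadj _ _ ha'b.symm) hl) hg.not_gt

theorem isSemiCaterpillar_of_contains [Finite V] (hG : G.IsLabel ℓ)
    (hA : RankedClass G.graph ℓ A r) (hls : LastShared G.graph ℓ A r) (hc : G.graph.Connected)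
    (hne : G.IsNontrivial) (hinc : (incOrder n).Contains G) (hdec : (decOrder n).Contains G) :
    G.IsSemiCaterpillar := by
  have ht := LastShared.isTree hA hG.injOn hls hc hne
  obtain ⟨A₁, r₁, hA₁, hback₁⟩ := exists_rankedClass_of_incOrder hG hinc
  obtain ⟨A₂, r₂, hA₂, hback₂⟩ := exists_rankedClass_of_decOrder hG hdec
  rcases hc.eq_or_eq_compl_of_alternating hA.alternating hA₁.alternating with rfl | rfl
  swap
  · exact isSemiCaterpillar_of_both_ranked hG hA hA₁ ht hne
  rcases hc.eq_or_eq_compl_of_alternating hA₁.alternating hA₂.alternating with rfl | rfl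
  swap
  · exact isSemiCaterpillar_of_both_ranked hG hA₁ hA₂ ht hne
  refine isSemiCaterpillar_of_lastShared hG hA hls ?_ hc hne
  intro a a' b c a'' ha ha' ha'' hab hab' hr hac hcb hle hadj
  rcases lt_trichotomy (ℓ s(a', b)) (ℓ s(a', c)) with hl | hl | hl
  · refine hback₁ a a' b c a'' ha ha' ha'' hab hab'
      ((hA.rank_lt_iff hA₁ ha ha' hab hab').1 hr) hac hl ?_ hadj
    by_contra! h
    exact absurd ((hA.rank_lt_iff hA₁ ha ha'' hab hadj).2 h) hle.not_gt
  · exact hcb (Sym2.congr_right.1 (hG.injOn hab' hac hl)).symm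
  · refine hback₂ a a' b c a'' ha ha' ha'' hab hab'
      ((hA.rank_lt_iff hA₂ ha ha' hab hab').1 hr) hac hl ?_ hadj
    by_contra! h
    exact absurd ((hA.rank_lt_iff hA₂ ha ha'' hab hadj).2 h) hle.not_gt

theorem isSemiCaterpillar_or_of_forall_contains [Finite V] (hc : G.graph.Connected)
    (hne : G.IsNontrivial)
    (h : ∀ K : EdgeOrderedGraph (Fin n), K.graph = hostGraph n → K.Contains G) :
    G.IsSemiCaterpillar ∨ G.reverse.IsSemiCaterpillar := by
  obtain ⟨ℓ, hG⟩ := G.exists_isLabel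
  obtain ⟨A, r, hA, -⟩ := exists_rankedClass_of_incOrder hG (h (incOrder n) rfl)
  rcases lastShared_or_of_sumOrder hG hA hc (h (sumOrder n) rfl) with hls | hls
  · exact Or.inl (isSemiCaterpillar_of_contains hG hA hls hc hne (h _ rfl) (h (decOrder n) rfl))
  · exact Or.inr (isSemiCaterpillar_of_contains (G := G.reverse) hG.neg hA.neg hls hc hne
      ((contains_reverse_iff G (incOrder n).reverse).2 (h _ rfl))
      ((contains_reverse_iff G (decOrder n).reverse).2 (h _ rfl)))

theorem le_ncard_edgeSet_hostGraph (hn : 4 ≤ n) :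
    n / 4 * (Nat.log 3 (n / 4) + 1) ≤ (hostGraph n).edgeSet.ncard := by
  have hM : n / 4 ≠ 0 := by omega
  have hpow : ∀ k < Nat.log 3 (n / 4) + 1, 3 ^ k ≤ n / 4 := fun k hk =>
    Nat.pow_le_of_le_log hM (by omega)
  -- the right vertex of position `n / 2 + y` is joined to the left one of position `3 ^ k` more
  have hlt : ∀ y < n / 4, ∀ k < Nat.log 3 (n / 4) + 1, y + 3 ^ k < n / 2 := by
    intro y hy k hk
    have := hpow k hk
    omega
  classical
  let f : ℕ × ℕ → Sym2 (Fin n) := fun p =>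
    if h : p.1 + 3 ^ p.2 < n ∧ n / 2 + p.1 < n then s(⟨p.1 + 3 ^ p.2, h.1⟩, ⟨n / 2 + p.1, h.2⟩)
    else s(⟨0, by omega⟩, ⟨0, by omega⟩)
  have hf : ∀ y < n / 4, ∀ k < Nat.log 3 (n / 4) + 1, ∃ h : y + 3 ^ k < n ∧ n / 2 + y < n,
      f (y, k) = s(⟨y + 3 ^ k, h.1⟩, ⟨n / 2 + y, h.2⟩) := by
    intro y hy k hk
    have := hlt y hy k hk
    have h : y + 3 ^ k < n ∧ n / 2 + y < n := by omega
    exact ⟨h, dif_pos h⟩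
  have := Set.ncard_le_ncard_of_injOn (s := ((Finset.range (n / 4) ×ˢ
    Finset.range (Nat.log 3 (n / 4) + 1) : Finset (ℕ × ℕ)) : Set (ℕ × ℕ)))
    (t := (hostGraph n).edgeSet) f ?_ ?_ (Set.toFinite _)
  · rwa [Set.ncard_coe_finset, Finset.card_product, Finset.card_range, Finset.card_range] at this
  · rintro ⟨y, k⟩ hp
    simp only [Finset.coe_product, Finset.coe_range, Set.mem_prod, Set.mem_Iio] at hp
    obtain ⟨h, he⟩ := hf y hp.1 k hp.2
    have := hlt y hp.1 k hp.2
    rw [he]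
    refine Or.inl ⟨this, ?_, k, ?_⟩
    · simp [leftSide]
    · simp [pos, this]; omega
  · rintro ⟨y, k⟩ hp ⟨y', k'⟩ hp' heq
    simp only [Finset.coe_product, Finset.coe_range, Set.mem_prod, Set.mem_Iio] at hp hp'
    obtain ⟨h, he⟩ := hf y hp.1 k hp.2
    obtain ⟨h', he'⟩ := hf y' hp'.1 k' hp'.2
    have h1 := hlt y hp.1 k hp.2
    have h2 := hlt y' hp'.1 k' hp'.2
    rw [he, he', Sym2.eq_iff] at heq
    simp only [Fin.mk.injEq] at heq
    have hy : y = y' := by omega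
    have hk : 3 ^ k = 3 ^ k' := by omega
    rw [hy, Nat.pow_right_injective (le_refl 2 |>.trans (by norm_num)) hk]

/-! ### The order chromatic number and the lower bound -/

theorem IsNontrivial.two_le_of_contains {m : ℕ} {H : SimpleGraph (Fin m)} (hne : G.IsNontrivial)
    (h : ∀ K : EdgeOrderedGraph (Fin m), K.graph = H → K.Contains G) :
    2 ≤ H.chromaticNumber := by
  -- some ordering of `H` exists because its edges can be labelled injectively
  obtain ⟨ι, hι⟩ := Countable.exists_injective_nat (Sym2 (Fin m))
  obtain ⟨f, -⟩ := h (ofLabel H ι hι.injOn) rfl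
  obtain ⟨e, he⟩ := hne
  induction e with | _ x y
  exact SimpleGraph.two_le_chromaticNumber_of_adj (f.toHom.map_adj he)

theorem orderChromaticNumber_eq_two (hne : G.IsNontrivial)
    (h : ∀ K : EdgeOrderedGraph (Fin n), K.graph = hostGraph n → K.Contains G) :
    G.orderChromaticNumber = 2 := by
  classical
  unfold orderChromaticNumber
  refine le_antisymm (sInf_le_of_le ⟨n, hostGraph n, h, rfl⟩ ?_) (le_sInf ?_)
  · refine SimpleGraph.chromaticNumber_le_iff_colorable.2 ⟨SimpleGraph.Coloring.mk
      (fun v => if v ∈ leftSide n then 0 else 1) fun {u v} huv => ?_⟩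
    have := hostGraph_alternating u v huv
    by_cases hu : u ∈ leftSide n <;> by_cases hv : v ∈ leftSide n <;> simp_all
  · rintro k ⟨m, H, hH, rfl⟩
    exact hne.two_le_of_contains hH

theorem le_turan_of_connected [Finite V] (hc : G.graph.Connected) (hne : G.IsNontrivial)
    (hG : ¬ ((G.IsSemiCaterpillar ∧ G.orderChromaticNumber = 2) ∨
      (G.reverse.IsSemiCaterpillar ∧ G.reverse.orderChromaticNumber = 2))) (hn : 4 ≤ n) :
    n / 4 * (Nat.log 3 (n / 4) + 1) ≤ turan n G := by
  refine (le_ncard_edgeSet_hostGraph hn).trans ?_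
  by_cases h : ∀ K : EdgeOrderedGraph (Fin n), K.graph = hostGraph n → K.Contains G
  · refine absurd ?_ hG
    have h2 := orderChromaticNumber_eq_two hne h
    have h2' : G.reverse.orderChromaticNumber = 2 :=
      orderChromaticNumber_eq_two (G := G.reverse) (n := n) hne
        fun K hK => (contains_reverse_iff G K.reverse).2 (h _ hK)
    exact (isSemiCaterpillar_or_of_forall_contains hc hne h).imp (⟨·, h2⟩) (⟨·, h2'⟩)
  · push Not at h
    obtain ⟨K, hK, hav⟩ := h
    rw [← hK]
    exact (isGreatest_turan n G hne).2 ⟨K, hav, rfl⟩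

theorem isBigO_turan_of_connected [Finite V] (hc : G.graph.Connected) (hne : G.IsNontrivial)
    (hG : ¬ ((G.IsSemiCaterpillar ∧ G.orderChromaticNumber = 2) ∨
      (G.reverse.IsSemiCaterpillar ∧ G.reverse.orderChromaticNumber = 2))) :
    (fun n : ℕ => (n : ℝ) * Real.log n) =O[Filter.atTop] (fun n : ℕ => (turan n G : ℝ)) := by
  refine Asymptotics.IsBigO.of_bound (8 * Real.log 24) ?_
  filter_upwards [Filter.eventually_ge_atTop 4] with n hn
  have hlow : ((n / 4 * (Nat.log 3 (n / 4) + 1) : ℕ) : ℝ) ≤ turan n G := by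
    exact_mod_cast le_turan_of_connected hc hne hG hn
  set M := n / 4 with hM
  set k := Nat.log 3 M + 1 with hk
  have hM1 : 1 ≤ M := by omega
  have hn8 : (n : ℝ) ≤ 8 * M := by
    have : n ≤ 8 * M := by omega
    exact_mod_cast this
  have hn1 : (1 : ℝ) ≤ n := by exact_mod_cast (by omega : 1 ≤ n)
  have hM3 : (M : ℝ) ≤ 3 ^ k := by
    exact_mod_cast (Nat.lt_pow_succ_log_self (by norm_num) M).le
  have hpow : (n : ℝ) ≤ 24 ^ k := by
    calc (n : ℝ) ≤ 8 * M := hn8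
      _ ≤ 8 ^ k * 3 ^ k := by
        gcongr
        exact le_self_pow₀ (by norm_num) (by omega)
      _ = 24 ^ k := by rw [← mul_pow]; norm_num
  have hlog : Real.log n ≤ k * Real.log 24 := by
    rw [← Real.log_pow]
    exact Real.log_le_log (by linarith) hpow
  have hlog0 : 0 ≤ Real.log n := Real.log_nonneg hn1
  rw [Real.norm_of_nonneg (by positivity), Real.norm_of_nonneg (by positivity)]
  calc (n : ℝ) * Real.log n ≤ (8 * M) * (k * Real.log 24) := by gcongr
    _ = 8 * Real.log 24 * ((M * k : ℕ) : ℝ) := by push_cast; ring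
    _ ≤ 8 * Real.log 24 * turan n G := by
      gcongr

end EdgeOrderedGraph

/-! ### The structure of semi-caterpillars of order chromatic number two -/

namespace EdgeOrderedGraph

variable {V W : Type*}

theorem exists_rankedClass_of_orderChromaticNumber {G : EdgeOrderedGraph V} {ℓ : Sym2 V → ℤ}
    (hG : G.IsLabel ℓ) (h : G.orderChromaticNumber = 2) :
    ∃ A r, RankedClass G.graph ℓ A r := by
  classical
  unfold orderChromaticNumber at h
  have hne : {k : ℕ∞ | ∃ (m : ℕ) (H : SimpleGraph (Fin m)), (∀ K : EdgeOrderedGraph (Fin m),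
      K.graph = H → K.Contains G) ∧ H.chromaticNumber = k}.Nonempty := by
    rw [Set.nonempty_iff_ne_empty]
    intro h0
    rw [h0, sInf_empty] at h
    exact absurd h (by decide)
  have hmem := csInf_mem hne
  rw [h] at hmem
  obtain ⟨m, H, hH, hχ⟩ := hmem
  obtain ⟨C⟩ := SimpleGraph.chromaticNumber_le_iff_colorable.1 hχ.le
  have hC : ∀ u v, H.Adj u v → (C u = 0 ↔ C v ≠ 0) := by
    intro u v huv
    have := C.valid huv
    generalize C u = c at *
    generalize C v = d at *
    decide +revert
  -- order `H` by the endpoint of colour `0`, then by the other endpoint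
  let p : Fin m → ℕ := fun v => if C v = 0 then v else 0
  let q : Fin m → ℕ := fun v => if C v = 0 then 0 else v
  have hex : ∀ e ∈ H.edgeSet, ∃ u v, C u = 0 ∧ C v ≠ 0 ∧ e = s(u, v) := by
    intro e he
    induction e with | _ u v
    have := hC u v he
    by_cases hu : C u = 0
    · exact ⟨u, v, hu, by tauto, rfl⟩
    · exact ⟨v, u, by tauto, hu, Sym2.eq_swap⟩
  have hinj : Set.InjOn (sumLabel p q) H.edgeSet := by
    intro e he f hf hef
    obtain ⟨u, v, hu, hv, rfl⟩ := hex e he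
    obtain ⟨u', v', hu', hv', rfl⟩ := hex f hf
    rw [sumLabel_eq] at hef
    simp only [p, q, hu, hv, hu', hv', if_true, if_false] at hef
    rw [Fin.ext (by omega : u.val = u'.val), Fin.ext (by omega : v.val = v'.val)]
  obtain ⟨φ, hφ, hadj, hlt⟩ := (hH (ofLabel H _ hinj) rfl).exists_map hG (isLabel_ofLabel _ _ hinj)
  refine ⟨{v | C (φ v) = 0}, fun v => (φ v).val, fun a _ b _ hab => hφ (Fin.ext (by simpa using hab)),
    fun x y hxy => hC _ _ (hadj x y hxy), ?_⟩
  intro a a' b b' ha ha' hab hab' hr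
  rw [hlt a b a' b' hab hab', sumLabel_lt]
  simp only [Set.mem_ofPred_eq] at ha ha'
  have hb := (hC _ _ (hadj _ _ hab)).1 ha
  have hb' := (hC _ _ (hadj _ _ hab')).1 ha'
  simp only [p, q, ha, ha', hb, hb', if_true, if_false]
  omega

theorem exists_enumeration [Finite V] [Nonempty V] {A : Set V} {r : V → ℤ}
    (h : Set.InjOn r A) : ∃ (k : ℕ) (α : ℕ → V), (∀ i < k, α i ∈ A) ∧
      (∀ i j, i < j → j < k → r (α i) < r (α j)) ∧ ∀ a ∈ A, ∃ i < k, α i = a := by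
  classical
  let s : Finset ℤ := (Set.toFinite A).toFinset.image r
  have hs : ∀ i : Fin s.card, ∃ a ∈ A, r a = s.orderEmbOfFin rfl i := by
    intro i
    obtain ⟨a, ha, h⟩ := Finset.mem_image.1 (Finset.orderEmbOfFin_mem s rfl i)
    exact ⟨a, by simpa using ha, h⟩
  choose f hfA hfr using hs
  refine ⟨s.card, fun i => if hi : i < s.card then f ⟨i, hi⟩ else Classical.arbitrary V, ?_, ?_, ?_⟩
  · intro i hi
    simp [hi, hfA]
  · intro i j hij hj
    simp only [hij.trans hj, hj, dif_pos, hfr]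
    exact (s.orderEmbOfFin rfl).strictMono hij
  · intro a ha
    have hmem : r a ∈ s := Finset.mem_image_of_mem r (by simpa using ha)
    have : r a ∈ Set.range (s.orderEmbOfFin rfl) := by
      rw [Finset.range_orderEmbOfFin]; exact hmem
    obtain ⟨i, hi⟩ := this
    refine ⟨i, i.2, ?_⟩
    simp only [i.2, dif_pos]
    exact h (hfA i) ha ((hfr i).trans hi)

/-- `Γ` is the union of `k` stars with centres `α 0, …, α (k - 1)`; in the order given by `ℓ` all
edges of a star precede those of the next one, and `α i` is joined to `β i` by its last edge. The
vertex `β i` is also a leaf of the star around `α (i + 1)`, and it is the only one that occurs in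
the earlier stars. -/
structure StarChain (Γ : SimpleGraph V) (ℓ : Sym2 V → ℤ) (k : ℕ) (α β : ℕ → V) : Prop where
  cover : ∀ x y, Γ.Adj x y → ∃ i < k, x = α i ∨ y = α i
  injective : ∀ i j, i < k → j < k → α i = α j → i = j
  not_adj : ∀ i j, i < k → j < k → ¬ Γ.Adj (α i) (α j)
  lt_of_lt : ∀ i j x y, i < j → j < k → Γ.Adj (α i) x → Γ.Adj (α j) y → ℓ s(α i, x) < ℓ s(α j, y)
  adj : ∀ i < k, Γ.Adj (α i) (β i)
  last : ∀ i < k, ∀ x, Γ.Adj (α i) x → x ≠ β i → ℓ s(α i, x) < ℓ s(α i, β i)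
  adj_succ : ∀ i, i + 1 < k → Γ.Adj (α (i + 1)) (β i)
  unique : ∀ i j x, j ≤ i → i + 1 < k → Γ.Adj (α j) x → Γ.Adj (α (i + 1)) x → x = β i

theorem exists_starChain [Finite V] {G : EdgeOrderedGraph V} {ℓ : Sym2 V → ℤ} {A : Set V}
    {r : V → ℤ} (hG : G.IsLabel ℓ) (hA : RankedClass G.graph ℓ A r) (hS : G.IsSemiCaterpillar) :
    ∃ k α β, 0 < k ∧ StarChain G.graph ℓ k α β := by
  classical
  obtain ⟨hne, ht, hcons⟩ := hS
  have := ht.connected.nonempty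
  obtain ⟨k, α, hαA, hαr, hαex⟩ := exists_enumeration hA.injOn
  have hnbr := ht.connected.exists_adj_of_edgeSet_nonempty hne
  have hβ : ∀ i, ∃ b, G.graph.Adj (α i) b ∧ ∀ x, G.graph.Adj (α i) x → ℓ s(α i, x) ≤ ℓ s(α i, b) := by
    intro i
    obtain ⟨b, hb, hmax⟩ := Set.exists_max_image {x | G.graph.Adj (α i) x} (fun x => ℓ s(α i, x))
      (Set.toFinite _) (hnbr (α i))
    exact ⟨b, hb, hmax⟩
  choose β hβadj hβmax using hβ
  have hlt : ∀ i j x y, i < j → j < k → G.graph.Adj (α i) x → G.graph.Adj (α j) y →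
      ℓ s(α i, x) < ℓ s(α j, y) := fun i j x y hij hj hx hy =>
    hA.lt_of_lt _ _ _ _ (hαA i (hij.trans hj)) (hαA j hj) hx hy (hαr i j hij hj)
  have hαinj : ∀ i j, i < k → j < k → α i = α j → i = j := by
    intro i j hi hj hij
    rcases lt_trichotomy i j with h | h | h
    · exact absurd (hαr i j h hj) (by simp [hij])
    · exact h
    · exact absurd (hαr j i h hi) (by simp [hij])
  have hex : ∀ e ∈ G.graph.edgeSet, ∃ i < k, ∃ b, b ∉ A ∧ G.graph.Adj (α i) b ∧ e = s(α i, b) := by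
    intro e he
    obtain ⟨a, b, ha, hab, rfl⟩ := hA.exists_eq he
    obtain ⟨i, hi, rfl⟩ := hαex a ha
    exact ⟨i, hi, b, hA.notMem ha hab, hab, rfl⟩
  have hadj_succ : ∀ i, i + 1 < k → G.graph.Adj (α (i + 1)) (β i) := by
    intro i hi
    -- the last edge at `α i` and the first edge at `α (i + 1)` are consecutive
    obtain ⟨c, hc, hmin⟩ := Set.exists_min_image {x | G.graph.Adj (α (i + 1)) x}
      (fun x => ℓ s(α (i + 1), x)) (Set.toFinite _) (hnbr (α (i + 1)))
    have hiA := hαA i (by omega)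
    have hi1A := hαA (i + 1) hi
    have hbA := hA.notMem hiA (hβadj i)
    have hcA := hA.notMem hi1A hc
    have hco : G.Consecutive ⟨s(α i, β i), hβadj i⟩ ⟨s(α (i + 1), c), hc⟩ := by
      refine ⟨(hG _ _).2 (hlt i (i + 1) _ _ (by omega) hi (hβadj i) hc), ?_⟩
      rintro ⟨⟨e, he⟩, h1, h2⟩
      obtain ⟨j, hj, b, -, hjb, rfl⟩ := hex e he
      have h1' : ℓ s(α i, β i) < ℓ s(α j, b) := (hG _ _).1 h1
      have h2' : ℓ s(α j, b) < ℓ s(α (i + 1), c) := (hG _ _).1 h2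
      rcases lt_trichotomy j i with h | rfl | h
      · exact absurd (hlt j i _ _ h (by omega) hjb (hβadj i)) h1'.not_gt
      · exact absurd (hβmax j b hjb) h1'.not_ge
      · rcases (Nat.succ_le_of_lt h).eq_or_lt with h | h
        · obtain rfl : i + 1 = j := h
          exact absurd (hmin b hjb) h2'.not_ge
        · exact absurd (hlt (i + 1) j _ _ h hj hc hjb) h2'.not_gt
    rcases hcons _ _ hco with ⟨v, hv1, hv2⟩ | ⟨⟨e, he⟩, h1, -, u, v, hu, hv, heq⟩
    · simp only [Sym2.mem_iff] at hv1 hv2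
      rcases hv1 with rfl | rfl <;> rcases hv2 with h | h
      · exact absurd (hαinj i (i + 1) (by omega) hi h) (by omega)
      · exact absurd (h ▸ hiA) hcA
      · exact absurd (h ▸ hi1A) hbA
      · rw [h]; exact hc
    · simp only [Sym2.mem_iff] at hu hv
      have h1' : ℓ s(α i, β i) < ℓ e := (hG _ _).1 h1
      simp only at heq
      subst heq
      have huv : G.graph.Adj u v := he
      rcases hu with rfl | rfl
      · exact absurd (hβmax i v huv) h1'.not_ge
      · rcases hv with rfl | rfl
        · exact huv.symm
        · exact absurd ((hA.alternating _ _ huv).2 hcA) hbA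
  refine ⟨k, α, β, ?_, ?_, hαinj, ?_, hlt, fun i _ => hβadj i, ?_, hadj_succ, ?_⟩
  · obtain ⟨e, he⟩ := hne
    obtain ⟨i, hi, -⟩ := hex e he
    omega
  · intro x y hxy
    obtain ⟨i, hi, b, -, -, he⟩ := hex s(x, y) hxy
    rcases Sym2.eq_iff.1 he with ⟨h, -⟩ | ⟨-, h⟩
    · exact ⟨i, hi, Or.inl h⟩
    · exact ⟨i, hi, Or.inr h⟩
  · exact fun i j hi hj h => hA.notMem (hαA i hi) h (hαA j hj)
  · intro i _ x hx hne
    refine lt_of_le_of_ne (hβmax i x hx) fun heq => hne ?_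
    exact Sym2.congr_right.1 (hG.injOn hx (hβadj i) heq)
  · -- Assign to the centre `α (l + 1)` its edge to `β l`, and to a vertex outside `A` its edge to
    -- the centre of the first star containing it. These are `|V| - 1` distinct edges, all edges of
    -- the tree, but `α (i + 1) x` would not be among them.
    intro i j x hji hi hjx hix
    by_contra hne'
    have hF : ∀ v, ∃ e, v ≠ α 0 → e ∈ G.graph.edgeSet ∧
        ((∃ l, l + 1 < k ∧ v = α (l + 1) ∧ e = s(α (l + 1), β l)) ∨
        (v ∉ A ∧ ∃ l < k, (∀ l' < l, ¬ G.graph.Adj (α l') v) ∧ e = s(α l, v))) := by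
      intro v
      by_cases hv0 : v = α 0
      · exact ⟨s(v, v), fun h => absurd hv0 h⟩
      by_cases hvA : v ∈ A
      · obtain ⟨l, hl, rfl⟩ := hαex v hvA
        obtain ⟨l, rfl⟩ : ∃ l', l = l' + 1 :=
          Nat.exists_eq_succ_of_ne_zero (by rintro rfl; exact hv0 rfl)
        exact ⟨_, fun _ => ⟨hadj_succ l hl, Or.inl ⟨l, hl, rfl, rfl⟩⟩⟩
      · have hex' : ∃ l, l < k ∧ G.graph.Adj (α l) v := by
          obtain ⟨w, hw⟩ := hnbr v
          have hwA : w ∈ A := by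
            by_contra hwA
            exact hvA ((hA.alternating v w hw).2 hwA)
          obtain ⟨l, hl, rfl⟩ := hαex w hwA
          exact ⟨l, hl, hw.symm⟩
        refine ⟨_, fun _ => ⟨(Nat.find_spec hex').2, Or.inr ⟨hvA, _, (Nat.find_spec hex').1, ?_, rfl⟩⟩⟩
        intro l' hl' hadj
        exact Nat.find_min hex' hl' ⟨hl'.trans (Nat.find_spec hex').1, hadj⟩
    choose F hF using hF
    have hmaps : ∀ v ∈ ({α 0}ᶜ : Set V), F v ∈ G.graph.edgeSet \ {s(α (i + 1), x)} := by
      intro v hv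
      obtain ⟨hmem, h⟩ := hF v hv
      refine ⟨hmem, fun heq => ?_⟩
      rw [Set.mem_singleton_iff] at heq
      rcases h with ⟨l, hl, rfl, h⟩ | ⟨hvA, l, hl, hmin, h⟩
      · rw [h] at heq
        rcases Sym2.eq_iff.1 heq with ⟨h1, h2⟩ | ⟨h1, h2⟩
        · have := hαinj _ _ hl hi h1
          obtain rfl : l = i := by omega
          exact hne' h2.symm
        · exact hA.notMem (hαA _ hi) hix (h1 ▸ hαA _ hl)
      · rw [h] at heq
        rcases Sym2.eq_iff.1 heq with ⟨h1, h2⟩ | ⟨h1, h2⟩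
        · subst h2
          have := hαinj _ _ hl hi h1
          exact hmin j (by omega) hjx
        · exact hvA (h2 ▸ hαA _ hi)
    have hFinj : Set.InjOn F ({α 0}ᶜ : Set V) := by
      intro v hv w hw hvw
      obtain ⟨-, ⟨l, hl, rfl, h⟩ | ⟨hvA, l, hl, hmin, h⟩⟩ := hF v hv <;>
      obtain ⟨-, ⟨l', hl', rfl, h'⟩ | ⟨hwA, l', hl', hmin', h'⟩⟩ := hF w hw <;>
      rw [h, h'] at hvw
      · rcases Sym2.eq_iff.1 hvw with ⟨h1, -⟩ | ⟨h1, h2⟩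
        · exact h1
        · exact absurd (h1 ▸ hαA _ hl) (hA.notMem (hαA _ (by omega)) (hadj_succ l' hl'))
      · rcases Sym2.eq_iff.1 hvw with ⟨h1, h2⟩ | ⟨h1, h2⟩
        · subst h2
          have := hαinj _ _ hl hl' h1
          exact absurd (hβadj l) (hmin' l (by omega))
        · exact absurd (h1 ▸ hαA _ hl) hwA
      · rcases Sym2.eq_iff.1 hvw with ⟨h1, h2⟩ | ⟨h1, h2⟩
        · subst h2
          have := hαinj _ _ hl hl' h1
          exact absurd (hβadj l') (hmin l' (by omega))
        · exact absurd (h2 ▸ hαA _ hl') hvA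
      · rcases Sym2.eq_iff.1 hvw with ⟨h1, h2⟩ | ⟨h1, h2⟩
        · exact h2
        · exact absurd (h2 ▸ hαA _ hl') hvA
    have h1 := Set.ncard_le_ncard_of_injOn F hmaps hFinj (Set.toFinite _)
    have h2 := Set.ncard_add_ncard_compl ({α 0} : Set V) (Set.toFinite _) (Set.toFinite _)
    have h3 := Set.ncard_sdiff_singleton_add_one
      (show s(α (i + 1), x) ∈ G.graph.edgeSet from hix) (Set.toFinite _)
    have h4 := (SimpleGraph.isTree_iff_connected_and_card.1 ht).2
    rw [Nat.card_coe_set_eq] at h4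
    rw [Set.ncard_singleton] at h2
    omega

end EdgeOrderedGraph

/-! ### Trimming sets of darts -/

namespace EdgeOrderedGraph

variable {V W : Type*}

open scoped Classical in
/-- The elements of `D` in the fibre of `p` under `f` that have a smaller label than `p`. -/
noncomputable def below {ι κ : Type*} (f : ι → κ) (s : ι → ℕ) (D : Finset ι) (p : ι) : Finset ι :=
  {q ∈ D | f q = f p ∧ s q < s p}

open scoped Classical in
/-- The elements of `D` with at least `T` elements of `D` below them in their fibre under `f`. -/
noncomputable def trim {ι κ : Type*} (f : ι → κ) (s : ι → ℕ) (T : ℕ) (D : Finset ι) : Finset ι :=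
  {p ∈ D | T ≤ (below f s D p).card}

theorem trim_subset {ι κ : Type*} (f : ι → κ) (s : ι → ℕ) (T : ℕ) (D : Finset ι) :
    trim f s T D ⊆ D := Finset.filter_subset _ _

theorem card_le_card_trim_add {ι κ : Type*} [Fintype κ] (f : ι → κ) (s : ι → ℕ) (T : ℕ)
    (D : Finset ι) (hs : ∀ p ∈ D, ∀ q ∈ D, f p = f q → s p = s q → p = q) :
    D.card ≤ (trim f s T D).card + T * Fintype.card κ := by
  classical
  rw [← Finset.card_filter_add_card_filter_not (s := D) (fun p => T ≤ (below f s D p).card)]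
  refine Nat.add_le_add le_rfl ?_
  refine Finset.card_le_mul_card_image_of_maps_to (f := f) (fun _ _ => Finset.mem_univ _) T ?_
  intro b _
  set B := Finset.filter (fun a => f a = b) ({p ∈ D | ¬ T ≤ (below f s D p).card}) with hB
  rcases B.eq_empty_or_nonempty with h0 | hne
  · simp [h0]
  obtain ⟨p, hp, hmax⟩ := B.exists_max_image s hne
  have hpD : p ∈ D ∧ (below f s D p).card < T ∧ f p = b := by
    simp only [hB, Finset.mem_filter, not_le] at hp
    tauto
  have hsub : B.erase p ⊆ below f s D p := by
    intro q hq
    obtain ⟨hqp, hqB⟩ := Finset.mem_erase.1 hq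
    have hqD : q ∈ D ∧ f q = b := by
      simp only [hB, Finset.mem_filter] at hqB
      tauto
    have hf : f q = f p := hqD.2.trans hpD.2.2.symm
    refine Finset.mem_filter.2 ⟨hqD.1, hf, lt_of_le_of_ne (hmax q hqB) fun h => hqp ?_⟩
    exact hs q hqD.1 p hpD.1 hf h
  have h1 := Finset.card_le_card hsub
  have h2 := Finset.card_erase_add_one hp
  omega

/-! ### Dominant darts -/

section Darts

variable (H : SimpleGraph W) (m : Sym2 W → ℕ)

/-- The label of the edge underlying a dart. -/
def dartLabel (m : Sym2 W → ℕ) (p : W × W) : ℕ := m s(p.1, p.2)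

theorem dartLabel_injOn_fst (hm : Set.InjOn m H.edgeSet) {D : Finset (W × W)}
    (hD : ∀ p ∈ D, H.Adj p.1 p.2) :
    ∀ p ∈ D, ∀ q ∈ D, p.1 = q.1 → dartLabel m p = dartLabel m q → p = q := by
  rintro ⟨a, b⟩ hp ⟨c, d⟩ hq h hl
  obtain rfl : a = c := h
  exact Prod.ext rfl (Sym2.congr_right.1 (hm (hD _ hp) (hD _ hq) hl))

theorem dartLabel_injOn_snd (hm : Set.InjOn m H.edgeSet) {D : Finset (W × W)}
    (hD : ∀ p ∈ D, H.Adj p.1 p.2) :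
    ∀ p ∈ D, ∀ q ∈ D, p.2 = q.2 → dartLabel m p = dartLabel m q → p = q := by
  rintro ⟨a, b⟩ hp ⟨c, d⟩ hq h hl
  obtain rfl : b = d := h
  exact Prod.ext (Sym2.congr_left.1 (hm (hD _ hp) (hD _ hq) hl)) rfl

variable [Fintype W]

open scoped Classical in
/-- The neighbours of `x` reached by edges with label at least `θ` and less than `t`. -/
noncomputable def window (x : W) (θ t : ℕ) : Finset W :=
  {w | H.Adj x w ∧ θ ≤ m s(x, w) ∧ m s(x, w) < t}

theorem mem_window {x w : W} {θ t : ℕ} :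
    w ∈ window H m x θ t ↔ H.Adj x w ∧ θ ≤ m s(x, w) ∧ m s(x, w) < t := by
  simp [window]

open scoped Classical in
/-- The darts `(u, v)` along an edge `e` such that, going down from `e` in the edge-order, one meets
`T` edges at `u` before meeting `T` edges at `v`. -/
noncomputable def dominantDarts (T : ℕ) : Finset (W × W) :=
  {p | H.Adj p.1 p.2 ∧ ∃ θ, T ≤ (window H m p.1 θ (dartLabel m p)).card ∧
    (window H m p.2 (θ + 1) (dartLabel m p)).card < T}

theorem mem_dominantDarts {T : ℕ} {p : W × W} : p ∈ dominantDarts H m T ↔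
    H.Adj p.1 p.2 ∧ ∃ θ, T ≤ (window H m p.1 θ (dartLabel m p)).card ∧
      (window H m p.2 (θ + 1) (dartLabel m p)).card < T := by
  simp [dominantDarts]

/-- Unless there are fewer than `T` edges below it at one of its ends, an edge gives a dominant dart
in one of the two directions. -/
theorem ncard_edgeSet_le_card_dominantDarts (hm : Set.InjOn m H.edgeSet) {T : ℕ} (hT : 0 < T) :
    H.edgeSet.ncard ≤ (dominantDarts H m T).card + T * Fintype.card W := by
  classical
  let P : Finset (W × W) := Finset.univ.filter (fun p => H.Adj p.1 p.2)
  have hP : ∀ p ∈ P, H.Adj p.1 p.2 := fun p hp => (Finset.mem_filter.1 hp).2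
  let B := P \ trim Prod.fst (dartLabel m) T P
  have hB : B.card ≤ T * Fintype.card W := by
    have h1 := card_le_card_trim_add Prod.fst (dartLabel m) T P (dartLabel_injOn_fst H m hm hP)
    have h2 := Finset.card_sdiff_add_card_eq_card (trim_subset Prod.fst (dartLabel m) T P)
    have h3 : B.card = (P \ trim Prod.fst (dartLabel m) T P).card := rfl
    omega
  have hsub : H.edgeSet ⊆ (((dominantDarts H m T ∪ B).image fun p => s(p.1, p.2) :
      Finset (Sym2 W)) : Set (Sym2 W)) := by
    intro e he
    induction e with | _ u v
    have huv : H.Adj u v := he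
    rw [Finset.mem_coe, Finset.mem_image]
    by_cases hbad : (u, v) ∈ B
    · exact ⟨(u, v), Finset.mem_union_right _ hbad, rfl⟩
    have huP : (u, v) ∈ P := Finset.mem_filter.2 ⟨Finset.mem_univ _, huv⟩
    have htrim : (u, v) ∈ trim Prod.fst (dartLabel m) T P := by
      by_contra h
      exact hbad (Finset.mem_sdiff.2 ⟨huP, h⟩)
    have h0 : T ≤ (window H m u 0 (m s(u, v))).card := by
      refine (Finset.mem_filter.1 htrim).2.trans ?_
      refine Finset.card_le_card_of_injOn Prod.snd ?_ ?_
      · rintro ⟨a, b⟩ hab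
        obtain ⟨h1, h2, h3⟩ := Finset.mem_filter.1 hab
        obtain rfl : a = u := h2
        exact (mem_window H m).2 ⟨hP _ h1, Nat.zero_le _, h3⟩
      · rintro ⟨a, b⟩ hab ⟨c, d⟩ hcd h
        obtain ⟨-, h2, -⟩ := Finset.mem_filter.1 hab
        obtain ⟨-, h2', -⟩ := Finset.mem_filter.1 hcd
        exact Prod.ext (h2.trans h2'.symm) h
    -- the least threshold above which there are fewer than `T` edges at either end
    have hempty : ∀ x, window H m x (m s(u, v)) (m s(u, v)) = ∅ := by
      intro x
      ext w
      simp only [mem_window, Finset.notMem_empty, iff_false]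
      omega
    have hex : ∃ θ, (window H m u θ (m s(u, v))).card < T ∧
        (window H m v θ (m s(u, v))).card < T :=
      ⟨m s(u, v), by rw [hempty]; simpa using hT, by rw [hempty]; simpa using hT⟩
    obtain ⟨θ, hθ⟩ : ∃ θ, Nat.find hex = θ + 1 := by
      refine Nat.exists_eq_succ_of_ne_zero fun h => ?_
      have := (Nat.find_spec hex).1
      rw [h] at this
      omega
    have hspec := Nat.find_spec hex
    have hmin := Nat.find_min hex (m := θ) (by omega)
    rw [hθ] at hspec
    by_cases hu : T ≤ (window H m u θ (m s(u, v))).card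
    · exact ⟨(u, v), Finset.mem_union_left _ ((mem_dominantDarts H m).2
        ⟨huv, θ, hu, hspec.2⟩), rfl⟩
    · refine ⟨(v, u), Finset.mem_union_left _ ((mem_dominantDarts H m).2
        ⟨huv.symm, θ, ?_⟩), Sym2.eq_swap⟩
      simp only [dartLabel]
      rw [Sym2.eq_swap]
      exact ⟨by omega, hspec.1⟩
  have h1 := Set.ncard_le_ncard hsub (Set.toFinite _)
  rw [Set.ncard_coe_finset] at h1
  have h2 := (Finset.card_image_le (s := dominantDarts H m T ∪ B)
    (f := fun p : W × W => s(p.1, p.2))).trans (Finset.card_union_le _ _)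
  omega

/-- The darts that will carry the last edge of the `i`-th star of a chain. To pass from one star to
the next, keep the darts `(u, v)` with many darts `(a, v)` below them, which can be
continued by the star of `u`, and among these the ones with many darts `(u, w)` below them,
which leave room in the star of `u` for both its entry and its exit. -/
noncomputable def stage (T : ℕ) : ℕ → Finset (W × W)
  | 0 => dominantDarts H m T
  | i + 1 => trim Prod.fst (dartLabel m) T (trim Prod.snd (dartLabel m) (2 * T) (stage T i))

theorem stage_subset (T i : ℕ) : stage H m T i ⊆ dominantDarts H m T := by
  induction i with
  | zero => exact subset_rfl
  | succ i ih => exact (trim_subset _ _ _ _).trans ((trim_subset _ _ _ _).trans ih)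

theorem adj_of_mem_stage {T i : ℕ} {p : W × W} (hp : p ∈ stage H m T i) : H.Adj p.1 p.2 :=
  ((mem_dominantDarts H m).1 (stage_subset H m T i hp)).1

theorem ncard_edgeSet_le_card_stage (hm : Set.InjOn m H.edgeSet) {T : ℕ} (hT : 0 < T) (i : ℕ) :
    H.edgeSet.ncard ≤ (stage H m T i).card + (T + 3 * T * i) * Fintype.card W := by
  induction i with
  | zero => simpa [stage] using ncard_edgeSet_le_card_dominantDarts H m hm hT
  | succ i ih =>
    have hadj : ∀ p ∈ stage H m T i, H.Adj p.1 p.2 := fun p hp => adj_of_mem_stage H m hp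
    have h1 := card_le_card_trim_add Prod.snd (dartLabel m) (2 * T) (stage H m T i)
      (dartLabel_injOn_snd H m hm hadj)
    have h2 := card_le_card_trim_add Prod.fst (dartLabel m) T
      (trim Prod.snd (dartLabel m) (2 * T) (stage H m T i))
      (dartLabel_injOn_fst H m hm fun p hp => hadj p (trim_subset _ _ _ _ hp))
    have h3 : (stage H m T (i + 1)).card = (trim Prod.fst (dartLabel m) T
      (trim Prod.snd (dartLabel m) (2 * T) (stage H m T i))).card := rfl
    have h4 : (T + 3 * T * (i + 1)) * Fintype.card W = (T + 3 * T * i) * Fintype.card W +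
      2 * T * Fintype.card W + T * Fintype.card W := by ring
    omega

end Darts

/-! ### Order-preserving maps of stars -/

theorem exists_strictMono_map [Nonempty W] (C : Finset V) (r : V → ℤ) (s : W → ℕ)
    (hr : Set.InjOn r C) : ∀ Z : Finset W, Set.InjOn s Z → C.card ≤ Z.card →
    ∃ g : V → W, (∀ c ∈ C, g c ∈ Z) ∧ ∀ c ∈ C, ∀ c' ∈ C, r c < r c' → s (g c) < s (g c') := by
  classical
  induction C using Finset.induction_on_max_value r with
  | empty => exact fun Z _ _ => ⟨fun _ => Classical.arbitrary W, by simp, by simp⟩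
  | insert c C hc hmax ih =>
    intro Z hs hcard
    rw [Finset.card_insert_of_notMem hc] at hcard
    obtain ⟨z, hz, hzmax⟩ := Z.exists_max_image s (Finset.card_pos.1 (by omega))
    obtain ⟨g, hgZ, hg⟩ := ih (hr.mono (by simp)) (Z.erase z) (hs.mono (by simp))
      (by rw [Finset.card_erase_of_mem hz]; omega)
    have hne : ∀ x ∈ C, x ≠ c := fun x hx h => hc (h ▸ hx)
    refine ⟨Function.update g c z, ?_, ?_⟩
    · intro x hx
      rcases Finset.mem_insert.1 hx with rfl | hx
      · simpa using hz
      · rw [Function.update_of_ne (hne x hx)]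
        exact Finset.mem_of_mem_erase (hgZ x hx)
    · intro x hx y hy hxy
      rcases Finset.mem_insert.1 hx with rfl | hxC <;> rcases Finset.mem_insert.1 hy with rfl | hyC
      · exact absurd hxy (lt_irrefl _)
      · exact absurd (hmax y hyC) hxy.not_ge
      · rw [Function.update_of_ne (hne x hxC), Function.update_self]
        obtain ⟨h1, h2⟩ := Finset.mem_erase.1 (hgZ x hxC)
        exact lt_of_le_of_ne (hzmax _ h2) fun h => h1 (hs h2 hz h)
      · rw [Function.update_of_ne (hne x hxC), Function.update_of_ne (hne y hyC)]
        exact hg x hxC y hyC hxy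

/-- An order-preserving map of a star with prescribed images `v` of a vertex `c₀` and `b` of the
last vertex `c₁`, the other vertices being sent to `Z₁` below `v` or to `Z₂` between `v` and `b`. -/
theorem exists_star_map (C : Finset V) (r : V → ℤ) (s : W → ℕ) (hr : Set.InjOn r C) {c₀ c₁ : V}
    (hc₀ : c₀ ∈ C) (hc₁ : ∀ c ∈ C, c ≠ c₁ → r c < r c₁) {v b : W} {Z₁ Z₂ : Finset W}
    (hZ₁ : ∀ z ∈ Z₁, s z < s v) (hZ₂ : ∀ z ∈ Z₂, s v < s z ∧ s z < s b)
    (hs₁ : Set.InjOn s Z₁) (hs₂ : Set.InjOn s Z₂) (hcard₁ : C.card ≤ Z₁.card)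
    (h : (c₀ = c₁ ∧ v = b) ∨ (c₀ ≠ c₁ ∧ s v < s b ∧ C.card ≤ Z₂.card)) :
    ∃ g : V → W, g c₀ = v ∧ g c₁ = b ∧ (∀ c ∈ C, c ≠ c₀ → c ≠ c₁ → g c ∈ Z₁ ∨ g c ∈ Z₂) ∧
      ∀ c ∈ C, ∀ c' ∈ C, r c < r c' → s (g c) < s (g c') := by
  classical
  have : Nonempty W := ⟨v⟩
  obtain ⟨g₁, hg₁, hlt₁⟩ := exists_strictMono_map C r s hr Z₁ hs₁ hcard₁
  have hvb : s v ≤ s b := by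
    rcases h with ⟨-, rfl⟩ | ⟨-, h, -⟩
    · exact le_rfl
    · exact h.le
  -- the vertices strictly between `c₀` and `c₁`
  obtain ⟨g₂, hg₂, hlt₂⟩ : ∃ g₂ : V → W,
      (∀ c ∈ C, r c₀ < r c → c ≠ c₁ → g₂ c ∈ Z₂) ∧
      ∀ c ∈ C, ∀ c' ∈ C, r c₀ < r c → c' ≠ c₁ → r c < r c' → s (g₂ c) < s (g₂ c') := by
    rcases h with ⟨rfl, -⟩ | ⟨-, -, hcard₂⟩
    · refine ⟨g₁, fun c hc h1 h2 => absurd (hc₁ c hc h2) h1.not_gt, ?_⟩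
      intro c _ c' hc' h1 h2 h3
      exact absurd (hc₁ c' hc' h2) (h1.trans h3).not_gt
    · obtain ⟨g₂, hg₂, hlt₂⟩ := exists_strictMono_map C r s hr Z₂ hs₂ hcard₂
      exact ⟨g₂, fun c hc _ _ => hg₂ c hc, fun c hc c' hc' _ _ => hlt₂ c hc c' hc'⟩
  refine ⟨fun c => if c = c₀ then v else if c = c₁ then b else if r c < r c₀ then g₁ c else g₂ c,
    by simp, ?_, ?_, ?_⟩
  · rcases h with ⟨rfl, rfl⟩ | ⟨h, -⟩
    · simp
    · simp [h.symm]
  · intro c hc h0 h1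
    simp only [h0, h1, if_false]
    split_ifs with h2
    · exact Or.inl (hg₁ c hc)
    · exact Or.inr (hg₂ c hc (lt_of_le_of_ne (not_lt.1 h2) fun h => h0 (hr hc hc₀ h.symm)) h1)
  · intro c hc c' hc' hcc
    have hlow : ∀ x ∈ C, s (g₁ x) < s v := fun x hx => hZ₁ _ (hg₁ x hx)
    have hmid : ∀ x ∈ C, r c₀ < r x → x ≠ c₁ → s v < s (g₂ x) ∧ s (g₂ x) < s b :=
      fun x hx h1 h2 => hZ₂ _ (hg₂ x hx h1 h2)
    have hcase : ∀ x ∈ C, x ≠ c₀ → ¬ r x < r c₀ → r c₀ < r x := fun x hx h0 h1 =>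
      lt_of_le_of_ne (not_lt.1 h1) fun h => h0 (hr hx hc₀ h.symm)
    have hc'1 : c ≠ c₁ := by
      rintro rfl
      exact absurd (hc₁ c' hc' (by rintro rfl; exact lt_irrefl _ hcc)) hcc.not_gt
    have hne : c ≠ c' := by rintro rfl; exact lt_irrefl _ hcc
    simp only [hc'1, if_false]
    by_cases h0 : c = c₀
    · subst h0
      simp only [hne.symm, if_true, if_false, hcc.not_gt]
      split_ifs with h1
      · subst h1
        rcases h with ⟨rfl, -⟩ | ⟨-, h, -⟩
        · exact absurd rfl hne
        · exact h
      · exact (hmid c' hc' hcc h1).1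
    · simp only [h0, if_false]
      by_cases h1 : r c < r c₀
      · simp only [h1, if_true]
        have hl := hlow c hc
        split_ifs with h2 h3 h4
        · exact hl
        · exact hl.trans_le hvb
        · exact hlt₁ c hc c' hc' hcc
        · exact hl.trans (hmid c' hc' (hcase c' hc' h2 h4) h3).1
      · have h1' := hcase c hc h0 h1
        have h2 : c' ≠ c₀ := by rintro rfl; exact h1 hcc
        simp only [h1, h2, (h1'.trans hcc).not_gt, if_false]
        split_ifs with h3
        · exact (hmid c hc h1' hc'1).2
        · exact hlt₂ c hc c' hc' h1' h3 hcc

end EdgeOrderedGraph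

/-! ### Embedding a chain of stars -/

namespace EdgeOrderedGraph

variable {V W : Type*}

/-- The vertices of the stars with centres `α 0, …, α i`. -/
def starVerts (Γ : SimpleGraph V) (α : ℕ → V) (i : ℕ) : Set V :=
  {x | ∃ j ≤ i, x = α j ∨ Γ.Adj (α j) x}

/-- `φ` embeds the union of the stars with centres `α 0, …, α i`, with its edge-order, into `H`. -/
structure PartialCopy (Γ : SimpleGraph V) (ℓ : Sym2 V → ℤ) (α : ℕ → V) (H : SimpleGraph W)
    (m : Sym2 W → ℕ) (i : ℕ) (φ : V → W) : Prop where
  injOn : Set.InjOn φ (starVerts Γ α i)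
  adj : ∀ j ≤ i, ∀ x, Γ.Adj (α j) x → H.Adj (φ (α j)) (φ x)
  lt_of_lt : ∀ j ≤ i, ∀ j' ≤ i, ∀ x x', Γ.Adj (α j) x → Γ.Adj (α j') x' →
    ℓ s(α j, x) < ℓ s(α j', x') → m s(φ (α j), φ x) < m s(φ (α j'), φ x')

variable {Γ : SimpleGraph V} {ℓ : Sym2 V → ℤ} {k : ℕ} {α β : ℕ → V} {H : SimpleGraph W}
  {m : Sym2 W → ℕ}

/-- Distinct neighbours of a centre have distinct images under an order-preserving map. -/
theorem eq_of_map_eq (hinj : Set.InjOn ℓ Γ.edgeSet) {a : V} {u : W} {g : V → W}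
    (hg : ∀ x x', Γ.Adj a x → Γ.Adj a x' → ℓ s(a, x) < ℓ s(a, x') → m s(u, g x) < m s(u, g x'))
    {x y : V} (hx : Γ.Adj a x) (hy : Γ.Adj a y) (h : g x = g y) : x = y := by
  rcases lt_trichotomy (ℓ s(a, x)) (ℓ s(a, y)) with hl | hl | hl
  · exact absurd (hg x y hx hy hl) (by simp [h])
  · exact Sym2.congr_right.1 (hinj hx hy hl)
  · exact absurd (hg y x hy hx hl) (by simp [h])

theorem StarChain.le_last (hS : StarChain Γ ℓ k α β) {i j : ℕ} (hj : j ≤ i) (hi : i < k) {x : V}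
    (hx : Γ.Adj (α j) x) : ℓ s(α j, x) < ℓ s(α i, β i) ∨ (j = i ∧ x = β i) := by
  rcases hj.eq_or_lt with rfl | hlt
  · by_cases h : x = β j
    · exact Or.inr ⟨rfl, h⟩
    · exact Or.inl (hS.last j hi x hx h)
  · exact Or.inl (hS.lt_of_lt j i x _ hlt hi hx (hS.adj i hi))

/-- A partial copy is extended by a star all of whose edges come later and which meets it only in
the image of `β i`. -/
theorem PartialCopy.extend (hS : StarChain Γ ℓ k α β) (hinj : Set.InjOn ℓ Γ.edgeSet) {i : ℕ}
    (hi : i + 1 < k) {φ : V → W} (hφ : PartialCopy Γ ℓ α H m i φ) {u : W} {g : V → W}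
    (hgβ : g (β i) = φ (β i)) (hgadj : ∀ x, Γ.Adj (α (i + 1)) x → H.Adj u (g x))
    (hglt : ∀ x x', Γ.Adj (α (i + 1)) x → Γ.Adj (α (i + 1)) x' →
      ℓ s(α (i + 1), x) < ℓ s(α (i + 1), x') → m s(u, g x) < m s(u, g x'))
    (hgnew : ∀ x, Γ.Adj (α (i + 1)) x → x ≠ β i → ∀ y ∈ starVerts Γ α i, φ y ≠ g x)
    (hunew : ∀ y ∈ starVerts Γ α i, φ y ≠ u)
    (habove : ∀ x, Γ.Adj (α (i + 1)) x → m s(φ (α i), φ (β i)) < m s(u, g x)) :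
    ∃ ψ : V → W, PartialCopy Γ ℓ α H m (i + 1) ψ ∧ ψ (α (i + 1)) = u ∧
      (∀ x, Γ.Adj (α (i + 1)) x → ψ x = g x) ∧ ∀ x ∈ starVerts Γ α i, ψ x = φ x := by
  classical
  let ψ : V → W := fun x => if x = α (i + 1) then u else if Γ.Adj (α (i + 1)) x then g x else φ x
  have hψu : ψ (α (i + 1)) = u := by simp [ψ]
  have hψg : ∀ x, Γ.Adj (α (i + 1)) x → ψ x = g x := fun x hx => by simp [ψ, hx, hx.ne']
  have hψφ : ∀ x ∈ starVerts Γ α i, ψ x = φ x := by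
    rintro x ⟨j, hj, hx⟩
    have h1 : x ≠ α (i + 1) := by
      rintro rfl
      rcases hx with h | h
      · have := hS.injective _ _ hi (by omega) h
        omega
      · exact hS.not_adj _ _ (by omega) hi h
    by_cases h2 : Γ.Adj (α (i + 1)) x
    · rcases hx with rfl | hx
      · exact absurd h2 (hS.not_adj _ _ hi (by omega))
      · rw [hψg x h2, hS.unique i j x hj hi hx h2, hgβ]
    · simp [ψ, h1, h2]
  have hcen : ∀ j ≤ i, α j ∈ starVerts Γ α i := fun j hj => ⟨j, hj, Or.inl rfl⟩
  have hleaf : ∀ j ≤ i, ∀ x, Γ.Adj (α j) x → x ∈ starVerts Γ α i :=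
    fun j hj x hx => ⟨j, hj, Or.inr hx⟩
  have hsplit : ∀ x ∈ starVerts Γ α (i + 1), x ∈ starVerts Γ α i ∨ x = α (i + 1) ∨
      (Γ.Adj (α (i + 1)) x ∧ x ≠ β i) := by
    rintro x ⟨j, hj, hx⟩
    rcases hj.eq_or_lt with rfl | hlt
    · rcases hx with rfl | hx
      · exact Or.inr (Or.inl rfl)
      · by_cases h : x = β i
        · exact Or.inl (h ▸ hleaf i le_rfl _ (hS.adj i (by omega)))
        · exact Or.inr (Or.inr ⟨hx, h⟩)
    · exact Or.inl ⟨j, by omega, hx⟩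
  refine ⟨ψ, ⟨?_, ?_, ?_⟩, hψu, hψg, hψφ⟩
  · intro x hx y hy hxy
    rcases hsplit x hx with hx | rfl | ⟨hx, hxβ⟩ <;> rcases hsplit y hy with hy | rfl | ⟨hy, hyβ⟩
    · rw [hψφ x hx, hψφ y hy] at hxy
      exact hφ.injOn hx hy hxy
    · rw [hψφ x hx, hψu] at hxy
      exact absurd hxy (hunew x hx)
    · rw [hψφ x hx, hψg y hy] at hxy
      exact absurd hxy (hgnew y hy hyβ x hx)
    · rw [hψφ y hy, hψu] at hxy
      exact absurd hxy.symm (hunew y hy)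
    · rfl
    · rw [hψg y hy, hψu] at hxy
      exact absurd hxy (hgadj y hy).ne
    · rw [hψφ y hy, hψg x hx] at hxy
      exact absurd hxy.symm (hgnew x hx hxβ y hy)
    · rw [hψg x hx, hψu] at hxy
      exact absurd hxy.symm (hgadj x hx).ne
    · rw [hψg x hx, hψg y hy] at hxy
      exact eq_of_map_eq hinj hglt hx hy hxy
  · intro j hj x hx
    rcases hj.eq_or_lt with rfl | hlt
    · rw [hψu, hψg x hx]
      exact hgadj x hx
    · rw [hψφ _ (hcen j (by omega)), hψφ _ (hleaf j (by omega) x hx)]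
      exact hφ.adj j (by omega) x hx
  · intro j hj j' hj' x x' hx hx' hlt
    rcases hj.eq_or_lt with rfl | hj <;> rcases hj'.eq_or_lt with rfl | hj'
    · rw [hψu, hψg x hx, hψg x' hx']
      exact hglt x x' hx hx' hlt
    · exact absurd (hS.lt_of_lt _ _ _ _ hj' hi hx' hx) hlt.not_gt
    · rw [hψu, hψg x' hx', hψφ _ (hcen j (by omega)), hψφ _ (hleaf j (by omega) x hx)]
      refine lt_of_le_of_lt ?_ (habove x' hx')
      rcases hS.le_last (i := i) (by omega) (by omega) hx with h | ⟨rfl, rfl⟩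
      · exact (hφ.lt_of_lt j (by omega) i le_rfl x _ hx (hS.adj i (by omega)) h).le
      · exact le_rfl
    · rw [hψφ _ (hcen j (by omega)), hψφ _ (hleaf j (by omega) x hx),
        hψφ _ (hcen j' (by omega)), hψφ _ (hleaf j' (by omega) x' hx')]
      exact hφ.lt_of_lt j (by omega) j' (by omega) x x' hx hx' hlt

/-- The dart `(a, b)` carries the last edge of the `i`-th star of some partial copy, and such copies
can be found outside every small set. The admissible size drops by two from star to star. -/
def Attains (Γ : SimpleGraph V) (ℓ : Sym2 V → ℤ) (k : ℕ) (α β : ℕ → V) (H : SimpleGraph W)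
    (m : Sym2 W → ℕ) (i : ℕ) (a b : W) : Prop :=
  ∀ S : Finset W, S.card + 2 * i ≤ 2 * k → a ∉ S → b ∉ S → ∃ φ : V → W,
    PartialCopy Γ ℓ α H m i φ ∧ φ (α i) = a ∧ φ (β i) = b ∧ ∀ x ∈ starVerts Γ α i, φ x ∉ S

theorem injOn_label_right (hm : Set.InjOn m H.edgeSet) {u : W} {Z : Finset W}
    (hZ : ∀ w ∈ Z, H.Adj u w) : Set.InjOn (fun w => m s(u, w)) Z := fun _ hx _ hy hxy =>
  Sym2.congr_right.1 (hm (hZ _ hx) (hZ _ hy) hxy)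

/-- An entry dart `(u, v)` for a star at `u` whose last edge is `ub`, together with a reservoir `Z` of
neighbours of `u` between the two. The proposition `P` decides whether the entry has to coincide
with the last edge. -/
theorem exists_entry (hm : Set.InjOn m H.edgeSet) {T c : ℕ} (S : Finset W)
    (hT : S.card + c + 1 ≤ T) {E : Finset (W × W)} (hE : ∀ p ∈ E, H.Adj p.1 p.2) {u b : W}
    (hub : (u, b) ∈ trim Prod.fst (dartLabel m) T E) (hbS : b ∉ S) (P : Prop) :
    ∃ (v : W) (Z : Finset W), (u, v) ∈ E ∧ v ∉ S ∧
      (∀ w ∈ Z, H.Adj u w ∧ m s(u, v) < m s(u, w) ∧ m s(u, w) < m s(u, b) ∧ w ∉ S) ∧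
      ((P ∧ v = b) ∨ (¬ P ∧ m s(u, v) < m s(u, b) ∧ c ≤ Z.card)) := by
  classical
  obtain ⟨hubE, hT'⟩ := Finset.mem_filter.1 hub
  by_cases hP : P
  · exact ⟨b, ∅, hubE, hbS, by simp, Or.inl ⟨hP, rfl⟩⟩
  let L := (below Prod.fst (dartLabel m) E (u, b)).image Prod.snd \ S
  have hL : ∀ w ∈ L, (u, w) ∈ E ∧ m s(u, w) < m s(u, b) ∧ w ∉ S := by
    intro w hw
    obtain ⟨h1, h2⟩ := Finset.mem_sdiff.1 hw
    obtain ⟨⟨x, y⟩, hp, hy⟩ := Finset.mem_image.1 h1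
    obtain ⟨h3, h4, h5⟩ := Finset.mem_filter.1 hp
    obtain rfl : y = w := hy
    obtain rfl : x = u := h4
    exact ⟨h3, h5, h2⟩
  have hLcard : c + 1 ≤ L.card := by
    have h1 : ((below Prod.fst (dartLabel m) E (u, b)).image Prod.snd).card - S.card ≤ L.card :=
      Finset.le_card_sdiff _ _
    rw [Finset.card_image_of_injOn] at h1
    · omega
    · rintro ⟨x, y⟩ hp ⟨x', y'⟩ hp' h
      obtain ⟨-, h4, -⟩ := Finset.mem_filter.1 hp
      obtain ⟨-, h4', -⟩ := Finset.mem_filter.1 hp'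
      exact Prod.ext (h4.trans h4'.symm) h
  -- enter through the lowest available edge
  obtain ⟨v, hv, hmin⟩ := L.exists_min_image (fun w => m s(u, w)) (Finset.card_pos.1 (by omega))
  obtain ⟨hvE, hvb, hvS⟩ := hL v hv
  refine ⟨v, L.erase v, hvE, hvS, ?_, Or.inr ⟨hP, hvb, ?_⟩⟩
  · intro w hw
    obtain ⟨hwv, hwL⟩ := Finset.mem_erase.1 hw
    obtain ⟨hwE, hwb, hwS⟩ := hL w hwL
    refine ⟨hE _ hwE, lt_of_le_of_ne (hmin w hwL) fun h => hwv ?_, hwb, hwS⟩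
    exact (Sym2.congr_right.1 (hm (hE _ hvE) (hE _ hwE) h)).symm
  · rw [Finset.card_erase_of_mem hv]
    omega

variable [Fintype V] [Fintype W]

theorem attains_zero (hS : StarChain Γ ℓ k α β) (hinj : Set.InjOn ℓ Γ.edgeSet)
    (hm : Set.InjOn m H.edgeSet) (hk : 0 < k) {T : ℕ} (hT : 2 * k + Fintype.card V ≤ T) {a b : W}
    (hab : (a, b) ∈ dominantDarts H m T) : Attains Γ ℓ k α β H m 0 a b := by
  classical
  intro S hcard haS hbS
  obtain ⟨hadj, θ, hθ, -⟩ := (mem_dominantDarts H m).1 hab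
  let Z := window H m a θ (m s(a, b)) \ S
  have hZ : ∀ w ∈ Z, H.Adj a w ∧ m s(a, w) < m s(a, b) ∧ w ∉ S := by
    intro w hw
    obtain ⟨h1, h2⟩ := Finset.mem_sdiff.1 hw
    obtain ⟨h3, -, h4⟩ := (mem_window H m).1 h1
    exact ⟨h3, h4, h2⟩
  have hZcard : Fintype.card V ≤ Z.card := by
    have : (window H m a θ (m s(a, b))).card - S.card ≤ Z.card := Finset.le_card_sdiff _ _
    have : T ≤ (window H m a θ (m s(a, b))).card := hθ
    omega
  let C : Finset V := Finset.univ.filter (fun x => Γ.Adj (α 0) x)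
  have hC : ∀ x, x ∈ C ↔ Γ.Adj (α 0) x := by simp [C]
  obtain ⟨g, -, hgb, hgZ, hglt⟩ := exists_star_map C (fun x => ℓ s(α 0, x)) (fun w => m s(a, w))
    (fun x hx y hy hxy => Sym2.congr_right.1 (hinj ((hC x).1 hx) ((hC y).1 hy) hxy))
    (c₀ := β 0) (c₁ := β 0) ((hC _).2 (hS.adj 0 hk))
    (fun c hc hne => hS.last 0 hk c ((hC c).1 hc) hne) (v := b) (b := b) (Z₁ := Z) (Z₂ := ∅)
    (fun z hz => (hZ z hz).2.1) (by simp) (injOn_label_right hm fun w hw => (hZ w hw).1) (by simp)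
    ((Finset.card_le_univ C).trans hZcard) (Or.inl ⟨rfl, rfl⟩)
  have hglt' : ∀ x x', Γ.Adj (α 0) x → Γ.Adj (α 0) x' → ℓ s(α 0, x) < ℓ s(α 0, x') →
      m s(a, g x) < m s(a, g x') :=
    fun x x' hx hx' h => hglt x ((hC x).2 hx) x' ((hC x').2 hx') h
  have hg : ∀ x, Γ.Adj (α 0) x → H.Adj a (g x) ∧ g x ∉ S := by
    intro x hx
    by_cases h : x = β 0
    · rw [h, hgb]
      exact ⟨hadj, hbS⟩
    · have := (hgZ x ((hC x).2 hx) h h).resolve_right (by simp)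
      exact ⟨(hZ _ this).1, (hZ _ this).2.2⟩
  let φ : V → W := fun x => if x = α 0 then a else g x
  have hφ0 : φ (α 0) = a := by simp [φ]
  have hφg : ∀ x, Γ.Adj (α 0) x → φ x = g x := fun x hx => by simp [φ, hx.ne']
  refine ⟨φ, ⟨?_, ?_, ?_⟩, hφ0, by rw [hφg _ (hS.adj 0 hk), hgb], ?_⟩
  · rintro x ⟨j, hj, hx⟩ y ⟨j', hj', hy⟩ hxy
    obtain rfl : j = 0 := by omega
    obtain rfl : j' = 0 := by omega
    rcases hx with rfl | hx <;> rcases hy with rfl | hy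
    · rfl
    · rw [hφ0, hφg y hy] at hxy
      exact absurd hxy (hg y hy).1.ne
    · rw [hφ0, hφg x hx] at hxy
      exact absurd hxy.symm (hg x hx).1.ne
    · rw [hφg x hx, hφg y hy] at hxy
      exact eq_of_map_eq hinj hglt' hx hy hxy
  · intro j hj x hx
    obtain rfl : j = 0 := by omega
    rw [hφ0, hφg x hx]
    exact (hg x hx).1
  · intro j hj j' hj' x x' hx hx' hlt
    obtain rfl : j = 0 := by omega
    obtain rfl : j' = 0 := by omega
    rw [hφ0, hφg x hx, hφg x' hx']
    exact hglt' x x' hx hx' hlt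
  · rintro x ⟨j, hj, hx⟩
    obtain rfl : j = 0 := by omega
    rcases hx with rfl | hx
    · rwa [hφ0]
    · rw [hφg x hx]
      exact (hg x hx).2

theorem attains_succ (hS : StarChain Γ ℓ k α β) (hinj : Set.InjOn ℓ Γ.edgeSet)
    (hm : Set.InjOn m H.edgeSet) {T : ℕ} (hT : 2 * k + 2 * Fintype.card V + 3 ≤ T) {i : ℕ}
    (hi : i + 1 < k) (ih : ∀ a b, (a, b) ∈ stage H m T i → Attains Γ ℓ k α β H m i a b) {u b : W}
    (hub : (u, b) ∈ stage H m T (i + 1)) : Attains Γ ℓ k α β H m (i + 1) u b := by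
  classical
  intro S hcard huS hbS
  let E := trim Prod.snd (dartLabel m) (2 * T) (stage H m T i)
  have hE : ∀ p ∈ E, p ∈ stage H m T i := fun p hp => trim_subset _ _ _ _ hp
  have hEadj : ∀ p ∈ E, H.Adj p.1 p.2 := fun p hp => adj_of_mem_stage H m (hE p hp)
  have hubadj : H.Adj u b := adj_of_mem_stage H m hub
  obtain ⟨v, Z₂, huv, hvS, hZ₂, hv⟩ := exists_entry (c := 2 * Fintype.card V) hm S (by omega) hEadj
    hub hbS (β i = β (i + 1))
  have huvadj : H.Adj u v := hEadj _ huv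
  obtain ⟨-, θ, hθ, hθ'⟩ := (mem_dominantDarts H m).1 (stage_subset H m T i (hE _ huv))
  -- the earlier stars have to avoid `u` and `b`, but may use `v`
  let S' := (insert u (insert b S)).erase v
  have hS' : S'.card ≤ S.card + 2 := by
    refine (Finset.card_le_card (Finset.erase_subset _ _)).trans ?_
    have h1 := Finset.card_insert_le u (insert b S)
    have h2 := Finset.card_insert_le b S
    omega
  -- a dart `(a, v)` below the reservoir at `u` to carry the last edge of the earlier stars
  obtain ⟨a, hav, haθ, haS'⟩ : ∃ a, (a, v) ∈ stage H m T i ∧ m s(a, v) ≤ θ ∧ a ∉ S' := by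
    by_contra! hno
    have hsub : (below Prod.snd (dartLabel m) (stage H m T i) (u, v)).image Prod.fst ⊆
        window H m v (θ + 1) (m s(u, v)) ∪ S' := by
      intro a ha
      obtain ⟨⟨x, y⟩, hp, hx⟩ := Finset.mem_image.1 ha
      obtain ⟨h3, h4, h5⟩ := Finset.mem_filter.1 hp
      obtain rfl : x = a := hx
      obtain rfl : y = v := h4
      have h5' : m s(x, y) < m s(u, y) := h5
      by_cases hle : m s(x, y) ≤ θ
      · exact Finset.mem_union_right _ (hno x h3 hle)
      · refine Finset.mem_union_left _ ((mem_window H m).2 ⟨(adj_of_mem_stage H m h3).symm, ?_⟩)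
        rw [Sym2.eq_swap]
        exact ⟨by omega, h5'⟩
    have h1 := (Finset.card_le_card hsub).trans (Finset.card_union_le _ _)
    rw [Finset.card_image_of_injOn] at h1
    · have h2 := (Finset.mem_filter.1 huv).2
      have h3 : (window H m v (θ + 1) (m s(u, v))).card < T := hθ'
      omega
    · rintro ⟨x, y⟩ hp ⟨x', y'⟩ hp' h
      obtain ⟨-, h4, -⟩ := Finset.mem_filter.1 hp
      obtain ⟨-, h4', -⟩ := Finset.mem_filter.1 hp'
      exact Prod.ext h (h4.trans h4'.symm)
  have havadj : H.Adj a v := adj_of_mem_stage H m hav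
  obtain ⟨φ, hφ, hφa, hφv, hφS'⟩ := ih a v hav S' (by omega) haS' (Finset.notMem_erase _ _)
  have hβmem : β i ∈ starVerts Γ α i := ⟨i, le_rfl, Or.inr (hS.adj i (by omega))⟩
  have hφu : ∀ y ∈ starVerts Γ α i, φ y ≠ u := by
    intro y hy h
    refine hφS' y hy ?_
    rw [h]
    exact Finset.mem_erase.2 ⟨huvadj.ne, Finset.mem_insert_self _ _⟩
  have hφS : ∀ y ∈ starVerts Γ α i, φ y ∉ S := by
    intro y hy h
    refine hφS' y hy (Finset.mem_erase.2 ⟨?_, by simp [h]⟩)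
    rintro h'
    exact hvS (h' ▸ h)
  let I := Finset.univ.image φ
  have hIcard : I.card ≤ Fintype.card V := Finset.card_image_le
  have hI : ∀ y, φ y ∈ I := fun y => Finset.mem_image_of_mem _ (Finset.mem_univ _)
  let Z₁ := window H m u θ (m s(u, v)) \ (S ∪ I)
  have hZ₁ : ∀ w ∈ Z₁, H.Adj u w ∧ θ ≤ m s(u, w) ∧ m s(u, w) < m s(u, v) ∧ w ∉ S ∧ w ∉ I := by
    intro w hw
    obtain ⟨h1, h2⟩ := Finset.mem_sdiff.1 hw
    obtain ⟨h3, h4, h5⟩ := (mem_window H m).1 h1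
    rw [Finset.mem_union, not_or] at h2
    exact ⟨h3, h4, h5, h2⟩
  have hZ₁card : Fintype.card V ≤ Z₁.card := by
    have h1 : (window H m u θ (m s(u, v))).card - (S ∪ I).card ≤ Z₁.card :=
      Finset.le_card_sdiff _ _
    have h2 : T ≤ (window H m u θ (m s(u, v))).card := hθ
    have h3 := Finset.card_union_le S I
    omega
  have hZ₂card : 2 * Fintype.card V ≤ Z₂.card → Fintype.card V ≤ (Z₂ \ I).card := by
    intro h
    have := Finset.le_card_sdiff I Z₂
    omega
  let C : Finset V := Finset.univ.filter (fun x => Γ.Adj (α (i + 1)) x)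
  have hC : ∀ x, x ∈ C ↔ Γ.Adj (α (i + 1)) x := by simp [C]
  have hCcard := Finset.card_le_univ C
  obtain ⟨g, hgv, hgb, hgZ, hglt⟩ := exists_star_map C (fun x => ℓ s(α (i + 1), x))
    (fun w => m s(u, w))
    (fun x hx y hy hxy => Sym2.congr_right.1 (hinj ((hC x).1 hx) ((hC y).1 hy) hxy))
    (c₀ := β i) (c₁ := β (i + 1)) ((hC _).2 (hS.adj_succ i hi))
    (fun c hc hne => hS.last (i + 1) hi c ((hC c).1 hc) hne) (v := v) (b := b) (Z₁ := Z₁)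
    (Z₂ := Z₂ \ I) (fun z hz => (hZ₁ z hz).2.2.1)
    (fun z hz => ⟨(hZ₂ z (Finset.mem_sdiff.1 hz).1).2.1, (hZ₂ z (Finset.mem_sdiff.1 hz).1).2.2.1⟩)
    (injOn_label_right hm fun w hw => (hZ₁ w hw).1)
    (injOn_label_right hm fun w hw => (hZ₂ w (Finset.mem_sdiff.1 hw).1).1)
    (hCcard.trans hZ₁card)
    (hv.imp id fun h => ⟨h.1, h.2.1, hCcard.trans (hZ₂card h.2.2)⟩)
  have hvb : m s(u, v) ≤ m s(u, b) := by
    rcases hv with ⟨-, rfl⟩ | ⟨-, h, -⟩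
    · exact le_rfl
    · exact h.le
  -- all edges of the new star come after the edge `av`
  have hg : ∀ x, Γ.Adj (α (i + 1)) x → H.Adj u (g x) ∧ g x ∉ S ∧ θ ≤ m s(u, g x) ∧
      (x ≠ β i → ∀ y ∈ starVerts Γ α i, φ y ≠ g x) := by
    have hθv : θ ≤ m s(u, v) := by
      have hpos : 0 < (window H m u θ (m s(u, v))).card := lt_of_lt_of_le (by omega) hθ
      obtain ⟨w, hw⟩ := Finset.card_pos.1 hpos
      have := (mem_window H m).1 hw
      omega
    intro x hx
    by_cases h0 : x = β i
    · rw [h0, hgv]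
      exact ⟨huvadj, hvS, hθv, fun h => absurd rfl h⟩
    by_cases h1 : x = β (i + 1)
    · rw [h1, hgb]
      refine ⟨hubadj, hbS, hθv.trans hvb, fun _ y hy h => hφS' y hy ?_⟩
      rw [h]
      refine Finset.mem_erase.2 ⟨?_, by simp⟩
      rintro rfl
      rcases hv with ⟨h, -⟩ | ⟨-, h, -⟩
      · exact h0 (h1.trans h.symm)
      · exact lt_irrefl _ h
    · rcases hgZ x ((hC x).2 hx) h0 h1 with hz | hz
      · obtain ⟨h2, h3, -, h4, h5⟩ := hZ₁ _ hz
        exact ⟨h2, h4, h3, fun _ y _ h => h5 (h ▸ hI y)⟩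
      · obtain ⟨h2, h3⟩ := Finset.mem_sdiff.1 hz
        obtain ⟨h4, h5, -, h6⟩ := hZ₂ _ h2
        exact ⟨h4, h6, hθv.trans h5.le, fun _ y _ h => h3 (h ▸ hI y)⟩
  have habove : ∀ x, Γ.Adj (α (i + 1)) x → m s(φ (α i), φ (β i)) < m s(u, g x) := by
    intro x hx
    obtain ⟨h1, -, h2, -⟩ := hg x hx
    rw [hφa, hφv]
    refine lt_of_le_of_ne (haθ.trans h2) fun h => ?_
    -- the edges `av` and `ug x` differ because `u` is neither `a` nor `v`
    have hmem : u ∈ s(a, v) := by rw [hm havadj h1 h]; simp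
    rcases Sym2.mem_iff.1 hmem with h | h
    · refine hφu (α i) ⟨i, le_rfl, Or.inl rfl⟩ (hφa.trans h.symm)
    · exact huvadj.ne h
  obtain ⟨ψ, hψ, hψu, hψg, hψφ⟩ := hφ.extend hS hinj hi (hgv.trans hφv.symm)
    (fun x hx => (hg x hx).1)
    (fun x x' hx hx' h => hglt x ((hC x).2 hx) x' ((hC x').2 hx') h)
    (fun x hx => (hg x hx).2.2.2) hφu habove
  refine ⟨ψ, hψ, hψu, by rw [hψg _ (hS.adj (i + 1) hi), hgb], ?_⟩
  rintro x ⟨j, hj, hx⟩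
  rcases hj.eq_or_lt with rfl | hlt
  · rcases hx with rfl | hx
    · rwa [hψu]
    · rw [hψg x hx]
      exact (hg x hx).2.1
  · have hmem : x ∈ starVerts Γ α i := ⟨j, by omega, hx⟩
    rw [hψφ x hmem]
    exact hφS x hmem

theorem attains_of_mem_stage (hS : StarChain Γ ℓ k α β) (hinj : Set.InjOn ℓ Γ.edgeSet)
    (hm : Set.InjOn m H.edgeSet) {T : ℕ} (hT : 2 * k + 2 * Fintype.card V + 3 ≤ T) (i : ℕ)
    (hi : i < k) : ∀ a b, (a, b) ∈ stage H m T i → Attains Γ ℓ k α β H m i a b := by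
  induction i with
  | zero => exact fun a b hab => attains_zero hS hinj hm hi (by omega) hab
  | succ i ih =>
    exact fun a b hab => attains_succ hS hinj hm hT hi (ih (by omega)) hab

/-! ### The linear upper bound -/

/-- A host with too many edges for the last stage to be empty contains the whole chain. -/
theorem contains_of_starChain {G : EdgeOrderedGraph V} {K : EdgeOrderedGraph W} (hG : G.IsLabel ℓ)
    (hK : K.IsLabel m) (hS : StarChain G.graph ℓ k α β) (hk : 0 < k)
    (hnbr : ∀ v, ∃ w, G.graph.Adj v w) {T : ℕ} (hT : 2 * k + 2 * Fintype.card V + 3 ≤ T)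
    (hcard : (T + 3 * T * (k - 1)) * Fintype.card W < K.graph.edgeSet.ncard) : K.Contains G := by
  have h1 := ncard_edgeSet_le_card_stage K.graph m hK.injOn (T := T) (by omega) (k - 1)
  obtain ⟨⟨a, b⟩, hab⟩ := Finset.card_pos.1
    (by omega : 0 < (stage K.graph m T (k - 1)).card)
  obtain ⟨φ, hφ, -⟩ := attains_of_mem_stage hS hG.injOn hK.injOn hT (k - 1) (by omega) a b hab ∅
    (by simp) (by simp) (by simp)
  have hcen : ∀ x y, G.graph.Adj x y → ∃ i ≤ k - 1, ∃ z, G.graph.Adj (α i) z ∧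
      s(x, y) = s(α i, z) := by
    intro x y hxy
    obtain ⟨i, hi, rfl | rfl⟩ := hS.cover x y hxy
    · exact ⟨i, by omega, y, hxy, rfl⟩
    · exact ⟨i, by omega, x, hxy.symm, Sym2.eq_swap⟩
  have hmap : ∀ x y a z, s(x, y) = s(a, z) → s(φ x, φ y) = s(φ a, φ z) := by
    intro x y a z h
    rw [← Sym2.map_mk, ← Sym2.map_mk, h]
  have hall : ∀ x, x ∈ starVerts G.graph α (k - 1) := by
    intro x
    obtain ⟨y, hxy⟩ := hnbr x
    obtain ⟨i, hi, rfl | rfl⟩ := hS.cover x y hxy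
    · exact ⟨i, by omega, Or.inl rfl⟩
    · exact ⟨i, by omega, Or.inr hxy.symm⟩
  refine contains_of_map hG hK φ (fun x y h => hφ.injOn (hall x) (hall y) h) ?_ ?_
  · intro x y hxy
    obtain ⟨i, hi, z, hz, he⟩ := hcen x y hxy
    rw [← SimpleGraph.mem_edgeSet, hmap _ _ _ _ he]
    exact hφ.adj i hi z hz
  · intro x y x' y' hxy hxy' hlt
    obtain ⟨i, hi, z, hz, he⟩ := hcen x y hxy
    obtain ⟨i', hi', z', hz', he'⟩ := hcen x' y' hxy'
    rw [hmap _ _ _ _ he, hmap _ _ _ _ he']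
    rw [he, he'] at hlt
    exact hφ.lt_of_lt i hi i' hi' z z' hz hz' hlt

theorem isBigO_turan_of_isSemiCaterpillar {G : EdgeOrderedGraph V} (hS : G.IsSemiCaterpillar)
    (hχ : G.orderChromaticNumber = 2) :
    (fun n : ℕ => (turan n G : ℝ)) =O[Filter.atTop] (fun n : ℕ => (n : ℝ)) := by
  obtain ⟨ℓ, hG⟩ := G.exists_isLabel
  obtain ⟨A, r, hA⟩ := exists_rankedClass_of_orderChromaticNumber hG hχ
  obtain ⟨k, α, β, hk, hchain⟩ := exists_starChain hG hA hS
  let T := 2 * k + 2 * Fintype.card V + 3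
  refine Asymptotics.IsBigO.of_bound ((T + 3 * T * (k - 1) : ℕ) : ℝ) (Filter.Eventually.of_forall ?_)
  intro n
  have hle : turan n G ≤ (T + 3 * T * (k - 1)) * n := by
    obtain ⟨K, hK, hcard⟩ := (isGreatest_turan n G hS.1).1
    rw [← hcard]
    by_contra! h
    obtain ⟨m, hm⟩ := K.exists_isLabel_nat
    refine hK (contains_of_starChain hG hm hchain hk
      (hS.2.1.connected.exists_adj_of_edgeSet_nonempty hS.1) le_rfl ?_)
    rwa [Fintype.card_fin]
  rw [Real.norm_of_nonneg (by positivity), Real.norm_of_nonneg (by positivity)]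
  exact_mod_cast hle

end EdgeOrderedGraph

/-! ### The dichotomy -/

theorem theorem2p3 {V : Type*} [Finite V] (G : EdgeOrderedGraph V) :
    (((G.IsSemiCaterpillar ∧ G.orderChromaticNumber = 2) ∨
        (G.reverse.IsSemiCaterpillar ∧ G.reverse.orderChromaticNumber = 2)) →
      (fun n : ℕ => (EdgeOrderedGraph.turan n G : ℝ)) =O[Filter.atTop] (fun n : ℕ => (n : ℝ))) ∧
    (G.graph.Connected → G.IsNontrivial →
      ¬ ((G.IsSemiCaterpillar ∧ G.orderChromaticNumber = 2) ∨
        (G.reverse.IsSemiCaterpillar ∧ G.reverse.orderChromaticNumber = 2)) →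
      (fun n : ℕ => (n : ℝ) * Real.log n) =O[Filter.atTop]
        (fun n : ℕ => (EdgeOrderedGraph.turan n G : ℝ))) := by
  have := Fintype.ofFinite V
  refine ⟨?_, fun hc hne hG => EdgeOrderedGraph.isBigO_turan_of_connected hc hne hG⟩
  rintro (⟨hS, hχ⟩ | ⟨hS, hχ⟩)
  · exact EdgeOrderedGraph.isBigO_turan_of_isSemiCaterpillar hS hχ
  · simpa only [EdgeOrderedGraph.turan_reverse] using
      EdgeOrderedGraph.isBigO_turan_of_isSemiCaterpillar hS hχ
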